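/- Consider a downlink network with finitely many tiers of base stations (BSs), indexed by a finite set $\mathcal K$, and a user at the origin of $\mathbb R^2$. The BS locations of tier $k\in\mathcal K$ form a homogeneous Poisson point process $\Phi_k$ on $\mathbb R^2$ of intensity $\lambda_k>0$, and the processes $\Phi_k$, $k\in\mathcal K$, are independent. Each BS of tier $k$ transmits with power $P_k>0$; the path-loss exponent is $\alpha>2$, the noise power is $N_0\ge 0$, and tier $k$ has the threshold $\tau_k>0$. The fading variables $h_{\mathbf x}$, one for each BS $\mathbf x$, are i.i.d. exponential with mean $1$ and independent of the BS locations. The user is served by the BS $\mathbf x^*$ that maximizes $P_k\|\mathbf x\|^{-\alpha}$ over all $k\in\mathcal K$ and $\mathbf x\in\Phi_k$; let $\mathcal S_i$ be the event that $\mathbf x^*\in\Phi_i$. On $\mathcal S_i$ put $$\mathrm{SINR}=\frac{P_i h_{\mathbf x^*}\|\mathbf x^*\|^{-\alpha}}{N_0+\sum_{j\in\mathcal K}\sum_{\mathbf x\in\Phi_j\setminus\{\mathbf x^*\}}P_j h_{\mathbf x}\|\mathbf x\|^{-\alpha}},$$ and define the coverage probability $\mathtt{P_c}=\mathbb P\big(\bigcup_{i\in\mathcal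 K}\{\mathrm{SINR}>\tau_i\}\cap\mathcal S_i\big)$. Let $\bar P_{j,i}=(P_j/P_i)^{1/\alpha}$ and $$\rho(\tau,\alpha)=1+\tau^{2/\alpha}\int_{\tau^{-2/\alpha}}^\infty\frac{dt}{1+t^{\alpha/2}}.$$ Then, all integrals being convergent, $$\mathtt{P_c}=\sum_{i\in\mathcal K}2\pi\lambda_i\int_0^\infty\exp\Big(-\frac{\tau_iN_0r^\alpha}{P_i}\Big)\exp\Big(-\pi r^2\sum_{j\in\mathcal K}\lambda_j\bar P_{j,i}^2\,\rho(\tau_i,\alpha)\Big)\,r\,dr.$$ If moreover $N_0=0$, then $$\mathtt{P_c}=\sum_{i\in\mathcal K}\frac{\lambda_iP_i^{2/\alpha}}{\sum_{j\in\mathcal K}\lambda_jP_j^{2/\alpha}\,\rho(\tau_i,\alpha)}.$$ -/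

import Mathlib

open MeasureTheory ProbabilityTheory
open scoped ENNReal NNReal

noncomputable section

/-- The plane `ℝ²` with its Euclidean norm and Lebesgue measure. -/
abbrev Plane : Type := EuclideanSpace ℝ (Fin 2)

/-- A random measure `Φ` (a measurable map into the space of measures with its usual `σ`-algebra)
is a Poisson point process with intensity measure `Λ` if the number of points in every measurable
set `A` with `Λ A < ∞` is Poisson distributed with mean `Λ A`, and the numbers of points in
pairwise disjoint measurable sets are independent. -/
structure IsPoissonPointProcess {Ω E : Type*} [MeasurableSpace Ω] [MeasurableSpace E]
    (μ : Measure Ω) (Φ : Ω → Measure E) (Λ : Measure E) : Prop where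
  measurable : Measurable Φ
  law : ∀ A : Set E, MeasurableSet A → Λ A ≠ ∞ →
    μ.map (fun ω => Φ ω A) =
      (poissonMeasure (Λ A).toNNReal).map (fun n : ℕ => (n : ℝ≥0∞))
  indep : ∀ (n : ℕ) (A : Fin n → Set E), (∀ i, MeasurableSet (A i)) →
    Pairwise (fun i j => Disjoint (A i) (A j)) → iIndepFun (fun i ω => Φ ω (A i)) μ

/-- The counting measure `∑ₙ δ_{xₙ}` of a sequence of points. -/
def countingMeasure (x : ℕ → Plane) : Measure Plane :=
  Measure.sum fun n => Measure.dirac (x n)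

/-- The downlink model with all tiers Poisson. The `n`-th base station of tier `k` is at `X k n`
and its link to the user (at the origin) has fading `h k n`.
The tiers are independent homogeneous Poisson point processes on the plane, tier `k` of intensity
`lam k` (so it almost surely has infinitely many points, which are listed by `X k`), and the
fading variables are i.i.d. exponential of mean one, independent of the locations. -/
structure IsPoissonHetNet {Ω κ : Type*} [MeasurableSpace Ω] (μ : Measure Ω) (lam : κ → ℝ)
    (X : κ → ℕ → Ω → Plane) (h : κ → ℕ → Ω → ℝ) : Prop where
  measurable_location : ∀ k n, Measurable (X k n)
  measurable_fading : ∀ k n, Measurable (h k n)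
  poisson : ∀ k, IsPoissonPointProcess μ (fun ω => countingMeasure fun n => X k n ω)
    (ENNReal.ofReal (lam k) • volume)
  indep_tiers : iIndepFun (fun k ω => countingMeasure fun n => X k n ω) μ
  fading_law : ∀ k n, μ.map (h k n) = expMeasure 1
  fading_indep : iIndepFun (fun (p : κ × ℕ) ω => h p.1 p.2 ω) μ
  indep_location_fading :
    IndepFun (fun ω (p : κ × ℕ) => X p.1 p.2 ω) (fun ω (p : κ × ℕ) => h p.1 p.2 ω) μ

section Coverage

variable {Ω κ : Type*} (α N₀ : ℝ) (P τ : κ → ℝ) (X : κ → ℕ → Ω → Plane) (h : κ → ℕ → Ω → ℝ)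

/-- Power received at the origin, averaged over fading, from base station `n` of tier `k`. -/
def averagePower (k : κ) (n : ℕ) (ω : Ω) : ℝ :=
  P k * ‖X k n ω‖ ^ (-α)

/-- Instantaneous power received at the origin from base station `n` of tier `k`. -/
def receivedPower (k : κ) (n : ℕ) (ω : Ω) : ℝ :=
  P k * h k n ω * ‖X k n ω‖ ^ (-α)

/-- Base station `n` of tier `i` is the serving one: it maximizes the average received power
among all base stations of all tiers. -/
def IsServing (i : κ) (n : ℕ) (ω : Ω) : Prop :=
  ∀ j m, averagePower α P X j m ω ≤ averagePower α P X i n ω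

/-- Interference when base station `n` of tier `i` serves: the total power from all others. -/
def interference (i : κ) (n : ℕ) (ω : Ω) : ℝ≥0∞ :=
  ∑' p : {p : κ × ℕ // p ≠ (i, n)}, ENNReal.ofReal (receivedPower α P X h p.1.1 p.1.2 ω)

/-- Signal to interference plus noise ratio when base station `n` of tier `i` serves. -/
def sinr (i : κ) (n : ℕ) (ω : Ω) : ℝ≥0∞ :=
  ENNReal.ofReal (receivedPower α P X h i n ω) /
    (ENNReal.ofReal N₀ + interference α P X h i n ω)

/-- The `i`-th tier coverage event: the serving base station belongs to tier `i` and the SINR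
exceeds the threshold `τ i`. -/
def tierCoverage (i : κ) : Set Ω :=
  {ω | ∃ n, IsServing α P X i n ω ∧ ENNReal.ofReal (τ i) < sinr α N₀ P X h i n ω}

/-- The coverage event. Its probability is the coverage probability. -/
def coverageEvent : Set Ω :=
  ⋃ i, tierCoverage α N₀ P τ X h i

end Coverage

/-- `ρ(τ, α) = 1 + τ^{2/α} ∫_{τ^{-2/α}}^∞ dt / (1 + t^{α/2})`. -/
def rho (τ α : ℝ) : ℝ :=
  1 + τ ^ (2 / α) * ∫ t in Set.Ioi (τ ^ (-(2 / α))), 1 / (1 + t ^ (α / 2))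

/-- `(P_j / P_i)^{1/α}`. -/
def powerRatio {κ : Type*} (α : ℝ) (P : κ → ℝ) (j i : κ) : ℝ :=
  (P j / P i) ^ (1 / α)

/-- The integrand, in the serving distance `r`, of the `i`-th tier coverage probability. -/
def coverageIntegrand {κ : Type*} [Fintype κ] (α N₀ : ℝ) (lam P τ : κ → ℝ) (i : κ) (r : ℝ) : ℝ :=
  Real.exp (-(τ i * N₀ * r ^ α / P i)) *
    Real.exp (-(Real.pi * r ^ 2 * ∑ j, lam j * powerRatio α P j i ^ 2 * rho (τ i) α)) * r

end

/-! Replace each station `x` of tier `k` by `t = ‖x‖² / P k ^ (2/α)`. Its average power becomes `t ^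
(-α/2)` in every tier, so the serving station is the one with least `t`. By
`map_scaledSqNorm_volume` the tiers become independent Poisson processes on the half line with
constant rates `ℓ k = lam k * π * P k ^ (2/α)`.

Given the locations, exceeding the threshold means that one exponential variable exceeds noise plus
a weighted sum of independent ones. Hence the conditional probability is the exponential of minus a
sum over the other stations (`measure_add_tsum_lt`, `measure_exceedsSinr`). If stations at `t ≤ s`
are given infinite loss, the event that nobody is closer than `s` enters the same exponential, and
averaging over locations becomes a Laplace functional.

The serving station is itself a random point. In place of Palm calculus, the half line is cut into
slices `(kδ, (k+1)δ]`. For a serving station of tier `i` in a slice, the functional omits the tier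
`i` points of that slice, so it is independent of their number (`lintegral_mul_expNeg`). Counting
all such points bounds the probability above with the kernel at the left endpoint. Requiring exactly
one such point and all other stations beyond the slice bounds it below with the kernel at the right
endpoint. The kernel is antitone, so the two Riemann sums squeeze its integral as `δ → 0`
(`measure_coverage`).

Finally `lintegral_one_sub_expNeg_lossExponent` evaluates the kernel through `rho`, and `s = r² / P
i ^ (2/α)` restores the serving distance. -/

noncomputable section

open Filter Topology

/-! ### The exponential on `[0, ∞]` and the Poisson distribution -/

/-- The function `x ↦ e^{-x}` on `[0, ∞]`. -/
def expNeg (x : ℝ≥0∞) : ℝ≥0∞ := EReal.exp (-(x : EReal))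

@[simp] lemma expNeg_zero : expNeg 0 = 1 := by simp [expNeg]

@[simp] lemma expNeg_top : expNeg ∞ = 0 := by simp [expNeg]

lemma expNeg_ofReal {x : ℝ} (hx : 0 ≤ x) :
    expNeg (ENNReal.ofReal x) = ENNReal.ofReal (Real.exp (-x)) := by
  rw [expNeg, EReal.coe_ennreal_ofReal, max_eq_left hx, ← EReal.coe_neg, EReal.exp_coe]

lemma expNeg_antitone : Antitone expNeg := fun x y hxy => by
  unfold expNeg
  exact EReal.exp_monotone (EReal.neg_le_neg_iff.2 (EReal.coe_ennreal_le_coe_ennreal_iff.2 hxy))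

lemma expNeg_le_one (x : ℝ≥0∞) : expNeg x ≤ 1 := by
  simpa using expNeg_antitone (zero_le (a := x))

lemma expNeg_ne_top (x : ℝ≥0∞) : expNeg x ≠ ∞ := ((expNeg_le_one x).trans_lt (by simp)).ne

lemma expNeg_add (x y : ℝ≥0∞) : expNeg (x + y) = expNeg x * expNeg y := by
  induction x with
  | top => simp
  | coe x =>
    induction y with
    | top => simp
    | coe y =>
      rw [← ENNReal.coe_add, ← ENNReal.ofReal_coe_nnreal, ← ENNReal.ofReal_coe_nnreal,
        ← ENNReal.ofReal_coe_nnreal, expNeg_ofReal (by positivity), expNeg_ofReal (by positivity),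
        expNeg_ofReal (by positivity), ← ENNReal.ofReal_mul (by positivity), ← Real.exp_add]
      congr 2
      push_cast
      ring

lemma expNeg_sum {ι : Type*} (s : Finset ι) (f : ι → ℝ≥0∞) :
    expNeg (∑ i ∈ s, f i) = ∏ i ∈ s, expNeg (f i) := by
  classical
  induction s using Finset.induction_on with
  | empty => simp
  | insert a s ha ih => rw [Finset.sum_insert ha, Finset.prod_insert ha, expNeg_add, ih]

lemma expNeg_natCast_mul (n : ℕ) (c : ℝ≥0∞) : expNeg (n * c) = expNeg c ^ n := by
  simpa using expNeg_sum (Finset.range n) fun _ => c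

lemma continuous_expNeg : Continuous expNeg := by
  unfold expNeg
  exact ENNReal.continuous_exp.comp (continuous_neg.comp continuous_coe_ennreal_ereal)

@[fun_prop]
lemma measurable_expNeg : Measurable expNeg := continuous_expNeg.measurable

lemma lintegral_poissonMeasure (r : ℝ≥0) (f : ℕ → ℝ≥0∞) :
    ∫⁻ n, f n ∂(poissonMeasure r) =
      ∑' n, ENNReal.ofReal (Real.exp (-r) * r ^ n / n.factorial) * f n := by
  simp [poissonMeasure, lintegral_sum_measure]

/-- With `q = expNeg c` this is the exponential series in `r * q`. The value `c = ∞` is allowed and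
gives the void probability, which infinite losses rely on. -/
lemma lintegral_expNeg_poissonMeasure (r : ℝ≥0) (c : ℝ≥0∞) :
    ∫⁻ n : ℕ, expNeg (n * c) ∂(poissonMeasure r) = expNeg (r * (1 - expNeg c)) := by
  obtain ⟨q, hq⟩ : ∃ q : ℝ≥0, expNeg c = q := ⟨_, (ENNReal.coe_toNNReal (expNeg_ne_top c)).symm⟩
  have hq1 : q ≤ 1 := by exact_mod_cast hq ▸ expNeg_le_one c
  rw [lintegral_poissonMeasure]
  simp_rw [expNeg_natCast_mul, hq]
  have h1 : HasSum (fun n : ℕ => Real.exp (-r) * ((r * q : ℝ) ^ n / n.factorial))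
      (Real.exp (-r) * Real.exp (r * q)) := by
    have := (NormedSpace.expSeries_div_hasSum_exp (r * q : ℝ)).mul_left (Real.exp (-r))
    rwa [← Real.exp_eq_exp_ℝ] at this
  have h2 : ∀ n : ℕ, ENNReal.ofReal (Real.exp (-r) * r ^ n / n.factorial) * (q : ℝ≥0∞) ^ n =
      ENNReal.ofReal (Real.exp (-r) * ((r * q : ℝ) ^ n / n.factorial)) := by
    intro n
    rw [← ENNReal.ofReal_coe_nnreal, ← ENNReal.ofReal_pow (by positivity),
      ← ENNReal.ofReal_mul (by positivity)]
    congr 1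
    rw [mul_pow]
    ring
  simp_rw [h2]
  rw [← ENNReal.ofReal_tsum_of_nonneg (fun n => by positivity) h1.summable, h1.tsum_eq,
    ← Real.exp_add]
  have h3 : (r : ℝ≥0∞) * (1 - (q : ℝ≥0∞)) = ENNReal.ofReal (r * (1 - q)) := by
    rw [ENNReal.ofReal_mul (by positivity), ENNReal.ofReal_sub _ (by positivity)]
    simp
  rw [h3, expNeg_ofReal (mul_nonneg (by positivity) (by simpa using hq1))]
  congr 2
  ring

lemma lintegral_id_poissonMeasure (r : ℝ≥0) :
    ∫⁻ n : ℕ, (n : ℝ≥0∞) ∂(poissonMeasure r) = r := by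
  rw [lintegral_poissonMeasure, tsum_eq_zero_add' ENNReal.summable]
  have h2 : ∀ n : ℕ, ENNReal.ofReal (Real.exp (-r) * r ^ (n + 1) / (n + 1).factorial) *
      ((n + 1 : ℕ) : ℝ≥0∞) = r * (ENNReal.ofReal (Real.exp (-r) * r ^ n / n.factorial) * 1) := by
    intro n
    rw [← ENNReal.ofReal_natCast, mul_one, ← ENNReal.ofReal_mul (by positivity),
      ← ENNReal.ofReal_coe_nnreal (p := r), ← ENNReal.ofReal_mul (by positivity)]
    congr 1
    rw [Nat.factorial_succ]
    push_cast
    field_simp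
    ring
  simp_rw [h2]
  rw [ENNReal.tsum_mul_left, ← lintegral_poissonMeasure r fun _ => 1]
  simp

/-! ### Laplace functionals of Poisson point processes -/

namespace IsPoissonPointProcess

variable {Ω E : Type*} [MeasurableSpace Ω] [MeasurableSpace E] {μ : Measure Ω}
  {Φ : Ω → Measure E} {Λ : Measure E}

lemma measurable_apply (hΦ : IsPoissonPointProcess μ Φ Λ) {A : Set E} (hA : MeasurableSet A) :
    Measurable fun ω => Φ ω A :=
  (Measure.measurable_coe hA).comp hΦ.measurable

lemma lintegral_comp_apply (hΦ : IsPoissonPointProcess μ Φ Λ) {A : Set E} (hA : MeasurableSet A)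
    (hΛ : Λ A ≠ ∞) {f : ℝ≥0∞ → ℝ≥0∞} (hf : Measurable f) :
    ∫⁻ ω, f (Φ ω A) ∂μ = ∫⁻ n : ℕ, f n ∂(poissonMeasure (Λ A).toNNReal) := by
  rw [← lintegral_map (f := f) hf (hΦ.measurable_apply hA), hΦ.law A hA hΛ,
    lintegral_map hf .of_discrete]

lemma lintegral_expNeg_mul_apply (hΦ : IsPoissonPointProcess μ Φ Λ) {A : Set E}
    (hA : MeasurableSet A) (hΛ : Λ A ≠ ∞) (c : ℝ≥0∞) :
    ∫⁻ ω, expNeg (c * Φ ω A) ∂μ = expNeg ((1 - expNeg c) * Λ A) := by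
  rw [hΦ.lintegral_comp_apply hA hΛ (f := fun x => expNeg (c * x)) (by fun_prop)]
  simp_rw [mul_comm c]
  rw [lintegral_expNeg_poissonMeasure, ENNReal.coe_toNNReal hΛ, mul_comm]

lemma lintegral_apply (hΦ : IsPoissonPointProcess μ Φ Λ) {A : Set E}
    (hA : MeasurableSet A) (hΛ : Λ A ≠ ∞) : ∫⁻ ω, Φ ω A ∂μ = Λ A := by
  rw [hΦ.lintegral_comp_apply hA hΛ (f := fun x => x) measurable_id, lintegral_id_poissonMeasure,
    ENNReal.coe_toNNReal hΛ]

lemma lintegral_apply_eq_one (hΦ : IsPoissonPointProcess μ Φ Λ) {A : Set E}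
    (hA : MeasurableSet A) (hΛ : Λ A ≠ ∞) :
    ∫⁻ ω, Set.indicator {1} 1 (Φ ω A) ∂μ = Λ A * expNeg (Λ A) := by
  rw [hΦ.lintegral_comp_apply hA hΛ (measurable_one.indicator (measurableSet_singleton _)),
    lintegral_poissonMeasure, tsum_eq_single 1]
  · obtain ⟨r, hr⟩ : ∃ r : ℝ≥0, Λ A = r := ⟨_, (ENNReal.coe_toNNReal hΛ).symm⟩
    rw [hr, ENNReal.toNNReal_coe, ← ENNReal.ofReal_coe_nnreal, expNeg_ofReal (by positivity),
      ← ENNReal.ofReal_mul (by positivity)]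
    simp [mul_comm]
  · intro n hn
    have : ((n : ℝ≥0∞)) ≠ 1 := by exact_mod_cast hn
    simp [this]

lemma iIndepFun_apply (hΦ : IsPoissonPointProcess μ Φ Λ) {ι : Type*} [Finite ι] {A : ι → Set E}
    (hA : ∀ i, MeasurableSet (A i)) (hd : Pairwise fun i j => Disjoint (A i) (A j)) :
    iIndepFun (fun i ω => Φ ω (A i)) μ := by
  obtain ⟨n, ⟨e⟩⟩ := Finite.exists_equiv_fin ι
  have := hΦ.indep n (fun i => A (e.symm i)) (fun i => hA _)
    (fun i j hij => hd (e.symm.injective.ne hij))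
  simpa using this.precomp e.injective

/-- The nonzero level sets of `v` and the set `A` are pairwise disjoint, so their counts are
independent and the expectation is a product of Poisson transforms. -/
lemma lintegral_mul_expNeg_simpleFunc (hΦ : IsPoissonPointProcess μ Φ Λ) {A : Set E}
    (hA : MeasurableSet A) {f : ℝ≥0∞ → ℝ≥0∞} (hf : Measurable f) (v : SimpleFunc E ℝ≥0∞)
    (hvA : ∀ x ∈ A, v x = 0) (hv : Λ (Function.support v) ≠ ∞) :
    ∫⁻ ω, f (Φ ω A) * expNeg (∫⁻ x, v x ∂(Φ ω)) ∂μ =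
      (∫⁻ ω, f (Φ ω A) ∂μ) * expNeg (∫⁻ x, (1 - expNeg (v x)) ∂Λ) := by
  classical
  -- The value `0` is dropped because its level set may have infinite intensity and may meet `A`.
  let S : Finset ℝ≥0∞ := v.range.filter (· ≠ 0)
  have hS : ∀ (g : ℝ≥0∞ → ℝ≥0∞), g 0 = 0 → ∀ m : Measure E,
      ∫⁻ x, g (v x) ∂m = ∑ c : S, g c * m (v ⁻¹' {(c : ℝ≥0∞)}) := by
    intro g hg m
    have h1 : ∫⁻ x, g (v x) ∂m = (v.map g).lintegral m := by
      rw [← SimpleFunc.lintegral_eq_lintegral]; rfl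
    rw [h1, SimpleFunc.map_lintegral, Finset.sum_coe_sort S fun c => g c * m (v ⁻¹' {c}),
      Finset.sum_filter]
    refine Finset.sum_congr rfl fun c _ => ?_
    by_cases hc : c = 0 <;> simp [hc, hg]
  -- `none` indexes `A`, so that a single independence statement covers `A` and all level sets.
  let B : Option S → Set E := fun o => o.elim A fun c => v ⁻¹' {(c : ℝ≥0∞)}
  have hB : ∀ o, MeasurableSet (B o) := by
    rintro (_ | c)
    · exact hA
    · exact v.measurableSet_preimage _
  have hSne : ∀ c : S, (c : ℝ≥0∞) ≠ 0 := fun c => (Finset.mem_filter.1 c.2).2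
  have hd : Pairwise fun i j => Disjoint (B i) (B j) := by
    rintro (_ | c) (_ | d) hcd
    · exact absurd rfl hcd
    · exact Set.disjoint_left.2 fun x hx hx' => hSne d (by
        rw [← show v x = d from hx', hvA x hx])
    · exact Set.disjoint_left.2 fun x hx' hx => hSne c (by
        rw [← show v x = c from hx', hvA x hx])
    · refine Set.disjoint_left.2 fun x hx hx' => hcd ?_
      have : (c : ℝ≥0∞) = d := (show v x = c from hx).symm.trans hx'
      rw [Subtype.ext this]
  let F : Option S → ℝ≥0∞ → ℝ≥0∞ := fun o => o.elim f fun c y => expNeg (c * y)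
  have hF : ∀ o, Measurable (F o) := by
    rintro (_ | c)
    · exact hf
    · change Measurable fun y => expNeg (c * y)
      fun_prop
  have hi := (hΦ.iIndepFun_apply hB hd).comp F hF
  have key := lintegral_prod_eq_prod_lintegral_of_indepFun Finset.univ _ hi
    fun o => (hF o).comp (hΦ.measurable_apply (hB o))
  simp only [Fintype.prod_option] at key
  have hfin : ∀ c : S, Λ (v ⁻¹' {(c : ℝ≥0∞)}) ≠ ∞ := fun c =>
    ((measure_mono fun x hx => by
      rw [Function.mem_support, show v x = c from hx]; exact hSne c).trans_lt hv.lt_top).ne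
  rw [hS (fun c => 1 - expNeg c) (by simp), expNeg_sum]
  simp_rw [hS (fun c => c) rfl, expNeg_sum]
  refine key.trans ?_
  congr 1
  exact Finset.prod_congr rfl fun c _ =>
    hΦ.lintegral_expNeg_mul_apply (v.measurableSet_preimage _) (hfin c) c

/-- The Laplace functional of a Poisson point process, jointly with the number of points of a set
where the test function vanishes. -/
theorem lintegral_mul_expNeg (hΦ : IsPoissonPointProcess μ Φ Λ) [SigmaFinite Λ] {A : Set E}
    (hA : MeasurableSet A) {f : ℝ≥0∞ → ℝ≥0∞} (hf : Measurable f)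
    (hfΦ : ∫⁻ ω, f (Φ ω A) ∂μ ≠ ∞) {v : E → ℝ≥0∞} (hv : Measurable v)
    (hvA : ∀ x ∈ A, v x = 0) :
    ∫⁻ ω, f (Φ ω A) * expNeg (∫⁻ x, v x ∂(Φ ω)) ∂μ =
      (∫⁻ ω, f (Φ ω A) ∂μ) * expNeg (∫⁻ x, (1 - expNeg (v x)) ∂Λ) := by
  -- Cutting off by spanning sets gives supports of finite intensity, as the simple case requires.
  let w : ℕ → SimpleFunc E ℝ≥0∞ := fun n =>
    (SimpleFunc.eapprox v n).restrict (spanningSets Λ n)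
  have hw : ∀ n x, w n x = (spanningSets Λ n).indicator (SimpleFunc.eapprox v n) x := fun n x => by
    rw [SimpleFunc.restrict_apply _ (measurableSet_spanningSets Λ n)]
  have hmono : Monotone fun n x => w n x := by
    intro m n hmn x
    simp only [hw]
    refine (Set.indicator_le_indicator_of_subset (monotone_spanningSets Λ hmn)
      (fun _ => zero_le) x).trans (Set.indicator_le_indicator ?_)
    exact SimpleFunc.monotone_eapprox v hmn x
  have hlim : ∀ x, Tendsto (fun n => w n x) atTop (𝓝 (v x)) := by
    intro x
    refine (SimpleFunc.tendsto_eapprox hv x).congr' ?_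
    filter_upwards [eventually_ge_atTop (spanningSetsIndex Λ x)] with n hn
    rw [hw, Set.indicator_of_mem]
    exact monotone_spanningSets Λ hn (mem_spanningSetsIndex Λ x)
  have hle : ∀ n x, w n x ≤ v x := fun n x =>
    Monotone.ge_of_tendsto (f := fun n => w n x) (fun a b hab => hmono hab x) (hlim x) n
  have heq : ∀ n, ∫⁻ ω, f (Φ ω A) * expNeg (∫⁻ x, w n x ∂(Φ ω)) ∂μ =
      (∫⁻ ω, f (Φ ω A) ∂μ) * expNeg (∫⁻ x, (1 - expNeg (w n x)) ∂Λ) := by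
    intro n
    refine hΦ.lintegral_mul_expNeg_simpleFunc hA hf (w n) (fun x hx => ?_) ?_
    · exact le_antisymm ((hle n x).trans (hvA x hx).le) (zero_le)
    · refine ((measure_mono fun x hx => ?_).trans_lt (measure_spanningSets_lt_top Λ n)).ne
      by_contra h
      exact hx (by rw [hw, Set.indicator_of_notMem h])
  have hΦint : ∀ m : Measure E, Tendsto (fun n => ∫⁻ x, w n x ∂m) atTop (𝓝 (∫⁻ x, v x ∂m)) :=
    fun m => lintegral_tendsto_of_tendsto_of_monotone (fun n => (w n).measurable.aemeasurable)
      (ae_of_all _ fun x a b hab => hmono hab x) (ae_of_all _ hlim)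
  have hL : Tendsto (fun n => ∫⁻ ω, f (Φ ω A) * expNeg (∫⁻ x, w n x ∂(Φ ω)) ∂μ) atTop
      (𝓝 (∫⁻ ω, f (Φ ω A) * expNeg (∫⁻ x, v x ∂(Φ ω)) ∂μ)) := by
    have hfm : Measurable fun ω => f (Φ ω A) := hf.comp (hΦ.measurable_apply hA)
    refine tendsto_lintegral_of_dominated_convergence' (fun ω => f (Φ ω A))
      (fun n => ?_) (fun n => ?_) hfΦ ?_
    · exact (hfm.mul (measurable_expNeg.comp
        ((Measure.measurable_lintegral (w n).measurable).comp hΦ.measurable))).aemeasurable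
    · exact ae_of_all _ fun ω => mul_le_of_le_one_right (zero_le) (expNeg_le_one _)
    -- Multiplication by a constant is continuous at `0` in `[0, ∞]` only if the constant is finite;
    -- integrability of `f` provides this almost everywhere.
    · have hfin := ae_lt_top hfm hfΦ
      filter_upwards [hfin] with ω hω
      exact ENNReal.Tendsto.const_mul ((continuous_expNeg.tendsto _).comp (hΦint _))
        (Or.inr hω.ne)
  have hR : Tendsto (fun n => ∫⁻ x, (1 - expNeg (w n x)) ∂Λ) atTop
      (𝓝 (∫⁻ x, (1 - expNeg (v x)) ∂Λ)) := by
    refine lintegral_tendsto_of_tendsto_of_monotone (fun n => ?_) ?_ ?_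
    · exact (measurable_const.sub (measurable_expNeg.comp (w n).measurable)).aemeasurable
    · exact ae_of_all _ fun x a b hab => tsub_le_tsub_left (expNeg_antitone (hmono hab x)) _
    · exact ae_of_all _ fun x => ENNReal.Tendsto.sub tendsto_const_nhds
        ((continuous_expNeg.tendsto _).comp (hlim x)) (Or.inl (by simp))
  simp_rw [heq] at hL
  exact tendsto_nhds_unique hL
    (ENNReal.Tendsto.const_mul ((continuous_expNeg.tendsto _).comp hR) (Or.inr hfΦ))

/-- The image of a Poisson point process is a Poisson point process. -/
lemma map (hΦ : IsPoissonPointProcess μ Φ Λ) {F : Type*} [MeasurableSpace F] {t : E → F}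
    (ht : Measurable t) : IsPoissonPointProcess μ (fun ω => (Φ ω).map t) (Λ.map t) where
  measurable := (Measure.measurable_map t ht).comp hΦ.measurable
  law A hA hΛ := by
    rw [Measure.map_apply ht hA] at hΛ
    simp_rw [Measure.map_apply ht hA]
    exact hΦ.law _ (ht hA) hΛ
  indep n A hA hd := by
    have h i ω : (Φ ω).map t (A i) = Φ ω (t ⁻¹' A i) := Measure.map_apply ht (hA i)
    simp_rw [h]
    exact hΦ.indep n _ (fun i => ht (hA i)) fun i j hij => (hd hij).preimage t

end IsPoissonPointProcess

/-- The joint Laplace functional of independent Poisson point processes. -/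
theorem lintegral_prod_mul_expNeg {Ω E κ : Type*} [MeasurableSpace Ω] [MeasurableSpace E]
    [Fintype κ] {μ : Measure Ω} {Φ : κ → Ω → Measure E} {Λ : κ → Measure E}
    [∀ k, SigmaFinite (Λ k)] (hΦ : ∀ k, IsPoissonPointProcess μ (Φ k) (Λ k))
    (hind : iIndepFun Φ μ) {A : κ → Set E} (hA : ∀ k, MeasurableSet (A k))
    {f : κ → ℝ≥0∞ → ℝ≥0∞} (hf : ∀ k, Measurable (f k))
    (hfΦ : ∀ k, ∫⁻ ω, f k (Φ k ω (A k)) ∂μ ≠ ∞) {v : κ → E → ℝ≥0∞} (hv : ∀ k, Measurable (v k))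
    (hvA : ∀ k, ∀ x ∈ A k, v k x = 0) :
    ∫⁻ ω, (∏ k, f k (Φ k ω (A k))) * expNeg (∑ k, ∫⁻ x, v k x ∂(Φ k ω)) ∂μ =
      (∏ k, ∫⁻ ω, f k (Φ k ω (A k)) ∂μ) * expNeg (∑ k, ∫⁻ x, (1 - expNeg (v k x)) ∂(Λ k)) := by
  have hG : ∀ k, Measurable fun m : Measure E => f k (m (A k)) * expNeg (∫⁻ x, v k x ∂m) :=
    fun k => ((hf k).comp (Measure.measurable_coe (hA k))).mul
      (measurable_expNeg.comp (Measure.measurable_lintegral (hv k)))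
  have key := lintegral_prod_eq_prod_lintegral_of_indepFun Finset.univ _ (hind.comp _ hG)
    fun k => (hG k).comp (hΦ k).measurable
  simp only [expNeg_sum, ← Finset.prod_mul_distrib]
  refine key.trans (Finset.prod_congr rfl fun k _ => ?_)
  exact (hΦ k).lintegral_mul_expNeg (hA k) (hf k) (hfΦ k) (hv k) (hvA k)

/-! ### Exponential fading -/

lemma measure_Ioi_expMeasure_one {x : ℝ} (hx : 0 ≤ x) :
    expMeasure 1 (Set.Ioi x) = ENNReal.ofReal (Real.exp (-x)) := by
  have := isProbabilityMeasure_expMeasure one_pos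
  have h := cdf_expMeasure_eq one_pos x
  rw [if_pos hx, cdf_eq_real, one_mul] at h
  have h2 := probReal_compl_eq_one_sub (μ := expMeasure 1) (measurableSet_Iic (a := x))
  rw [h, Set.compl_Iic] at h2
  rw [← ofReal_measureReal (measure_ne_top _ _), h2]
  congr 1
  ring

/-- Tilting the unit exponential density by `e^{-ax}` gives `(1 + a)⁻¹` times the density of rate `1
+ a`. The logarithmic form turns products over interferers into sums of exponents. -/
lemma lintegral_expNeg_expMeasure_one (a : ℝ≥0) :
    ∫⁻ x, expNeg (a * ENNReal.ofReal x) ∂(expMeasure 1) =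
      expNeg (ENNReal.ofReal (Real.log (1 + a))) := by
  have ha : (0 : ℝ) < 1 + a := by positivity
  have h1 : expMeasure 1 = volume.withDensity (exponentialPDF 1) := rfl
  have hm : ∀ r, Measurable (exponentialPDF r) := fun r =>
    (measurable_exponentialPDFReal r).ennreal_ofReal
  rw [h1, lintegral_withDensity_eq_lintegral_mul _ (hm 1)
    (by fun_prop)]
  have h2 : ∀ x, (exponentialPDF 1 * fun x => expNeg (a * ENNReal.ofReal x)) x =
      ENNReal.ofReal (1 + a)⁻¹ * exponentialPDF (1 + a) x := by
    intro x
    rw [Pi.mul_apply]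
    rcases lt_or_ge x 0 with hx | hx
    · rw [exponentialPDF_of_neg hx, exponentialPDF_of_neg hx]
      simp
    · rw [exponentialPDF_of_nonneg hx, exponentialPDF_of_nonneg hx, ← ENNReal.ofReal_coe_nnreal,
        ← ENNReal.ofReal_mul (by positivity), expNeg_ofReal (by positivity),
        ← ENNReal.ofReal_mul (by positivity), ← ENNReal.ofReal_mul (by positivity),
        ← mul_assoc, inv_mul_cancel₀ ha.ne', one_mul, one_mul, one_mul, ← Real.exp_add]
      congr 2
      ring
  simp_rw [h2]
  rw [lintegral_const_mul _ (hm _), lintegral_exponentialPDF_eq_one ha, mul_one,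
    expNeg_ofReal (Real.log_nonneg (by simp)), Real.exp_neg, Real.exp_log ha]

/-- Disintegration of an event along one of two independent random variables. -/
lemma measure_indepFun_eq_lintegral {Ω E F : Type*} [MeasurableSpace Ω] [MeasurableSpace E]
    [MeasurableSpace F] {μ : Measure Ω} [IsFiniteMeasure μ] {f : Ω → E} {g : Ω → F}
    (hfg : IndepFun f g μ) (hf : Measurable f) (hg : Measurable g) {S : Set (E × F)}
    (hS : MeasurableSet S) :
    μ {ω | (f ω, g ω) ∈ S} = ∫⁻ ω, μ {ω' | (f ω, g ω') ∈ S} ∂μ := by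
  have h1 : μ {ω | (f ω, g ω) ∈ S} = μ.map (fun ω => (f ω, g ω)) S :=
    (Measure.map_apply (hf.prodMk hg) hS).symm
  rw [h1, (indepFun_iff_map_prod_eq_prod_map_map hf.aemeasurable hg.aemeasurable).1 hfg,
    Measure.prod_apply hS, lintegral_map (measurable_measure_prodMk_left hS) hf]
  refine lintegral_congr fun ω => ?_
  rw [Measure.map_apply hg (measurable_prodMk_left hS)]
  rfl

section Fading

lemma measurable_add_tsum_mul {Ω ι : Type*} {mΩ : MeasurableSpace Ω} [Countable ι] {H : ι → Ω → ℝ}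
    (hm : ∀ p, Measurable (H p)) (a : ι → ℝ≥0) (c : ℝ≥0∞) :
    Measurable fun ω => c + ∑' p, a p * ENNReal.ofReal (H p ω) :=
  measurable_const.add (Measurable.tsum fun p => ((hm p).ennreal_ofReal.const_mul _))

lemma measure_lt_ofReal_of_map_eq_expMeasure {Ω : Type*} [MeasurableSpace Ω] {μ : Measure Ω}
    {h : Ω → ℝ} (hm : Measurable h) (hl : μ.map h = expMeasure 1) (z : ℝ≥0∞) :
    μ {ω | z < ENNReal.ofReal (h ω)} = expNeg z := by
  induction z with
  | top => simp
  | coe z =>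
    rw [← ENNReal.ofReal_coe_nnreal, expNeg_ofReal (by positivity),
      ← measure_Ioi_expMeasure_one (by positivity), ← hl, Measure.map_apply hm measurableSet_Ioi]
    congr 1
    ext ω
    simp

variable {Ω ι : Type*} [MeasurableSpace Ω] [Countable ι] {μ : Measure Ω} [IsProbabilityMeasure μ]
  {H : ι → Ω → ℝ}

/-- Independence settles finite sums and dominated convergence, with bound `1`, the full one. No
summability of `a` is needed: divergence just gives `expNeg ∞ = 0`. -/
lemma lintegral_expNeg_tsum (hm : ∀ p, Measurable (H p)) (hl : ∀ p, μ.map (H p) = expMeasure 1)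
    (hi : iIndepFun H μ) (a : ι → ℝ≥0) :
    ∫⁻ ω, expNeg (∑' p, a p * ENNReal.ofReal (H p ω)) ∂μ =
      expNeg (∑' p, ENNReal.ofReal (Real.log (1 + a p))) := by
  have hfin : ∀ s : Finset ι, ∫⁻ ω, expNeg (∑ p ∈ s, a p * ENNReal.ofReal (H p ω)) ∂μ =
      expNeg (∑ p ∈ s, ENNReal.ofReal (Real.log (1 + a p))) := by
    intro s
    have hg : ∀ p, Measurable fun x : ℝ => expNeg (a p * ENNReal.ofReal x) := fun p => by fun_prop
    simp_rw [expNeg_sum]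
    refine (lintegral_prod_eq_prod_lintegral_of_indepFun s _ (hi.comp _ hg)
      fun p => (hg p).comp (hm p)).trans (Finset.prod_congr rfl fun p _ => ?_)
    rw [← lintegral_expNeg_expMeasure_one, ← hl p, lintegral_map (hg p) (hm p)]
    rfl
  have hL : Tendsto (fun s : Finset ι => ∫⁻ ω, expNeg (∑ p ∈ s, a p * ENNReal.ofReal (H p ω)) ∂μ)
      atTop (𝓝 (∫⁻ ω, expNeg (∑' p, a p * ENNReal.ofReal (H p ω)) ∂μ)) := by
    refine tendsto_lintegral_filter_of_dominated_convergence (fun _ => 1)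
      (Eventually.of_forall fun s => ?_) (Eventually.of_forall fun s => ?_) (by simp) ?_
    · fun_prop
    · exact ae_of_all _ fun ω => expNeg_le_one _
    · exact ae_of_all _ fun ω => (continuous_expNeg.tendsto _).comp ENNReal.summable.hasSum
  simp_rw [hfin] at hL
  exact tendsto_nhds_unique hL ((continuous_expNeg.tendsto _).comp ENNReal.summable.hasSum)

/-- The probability that an exponential fading variable exceeds a weighted sum of independent
ones. -/
theorem measure_add_tsum_lt (hm : ∀ p, Measurable (H p)) (hl : ∀ p, μ.map (H p) = expMeasure 1)
    (hi : iIndepFun H μ) (p₀ : ι) (a : {p // p ≠ p₀} → ℝ≥0) (c : ℝ≥0∞) :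
    μ {ω | c + ∑' p, a p * ENNReal.ofReal (H p ω) < ENNReal.ofReal (H p₀ ω)} =
      expNeg (c + ∑' p, ENNReal.ofReal (Real.log (1 + a p))) := by
  let Z : Ω → ℝ≥0∞ := fun ω => c + ∑' p, a p * ENNReal.ofReal (H p ω)
  have hZm : Measurable Z := measurable_add_tsum_mul (fun p : {p // p ≠ p₀} => hm p) a c
  have hind : IndepFun Z (H p₀) μ := by
    -- The σ-algebra generated by all `H q` with `q ≠ p₀` is independent of `H p₀`, and `Z` is
    -- measurable for it.
    have h1 := indep_iSup_of_disjoint (fun p => (hm p).comap_le) hi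
      (S := {p | p ≠ p₀}) (T := {p₀}) (by simp)
    refine indep_of_indep_of_le_left (indep_of_indep_of_le_right h1 ?_) ?_
    · simp
    · rw [← measurable_iff_comap_le]
      refine measurable_add_tsum_mul
        (mΩ := ⨆ q ∈ {q | q ≠ p₀}, MeasurableSpace.comap (H q) inferInstance) (fun p => ?_) a c
      rw [measurable_iff_comap_le]
      exact le_iSup₂ (f := fun (q : ι) (_ : q ∈ {q | q ≠ p₀}) =>
        MeasurableSpace.comap (H q) inferInstance) p.1 p.2
  have h1 := measure_indepFun_eq_lintegral hind hZm (hm p₀)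
    (S := {q | q.1 < ENNReal.ofReal q.2})
    (measurableSet_lt measurable_fst measurable_snd.ennreal_ofReal)
  refine h1.trans ?_
  simp only [Set.mem_ofPred_eq, measure_lt_ofReal_of_map_eq_expMeasure (hm p₀) (hl p₀)]
  simp only [Z, expNeg_add]
  rw [lintegral_const_mul' _ _ (expNeg_ne_top c)]
  congr 1
  exact lintegral_expNeg_tsum (H := fun p : {p // p ≠ p₀} => H p) (fun p => hm p) (fun p => hl p)
    (hi.precomp (g := Subtype.val) Subtype.val_injective) a

end Fading

/-! ### Coverage conditioned on the locations -/

section Coverage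

variable {ι : Type*}

/-- With normalized squared distances `t` and fading `h`, transmitter `p` has signal to
interference plus noise ratio above `τ`. -/
def ExceedsSinr (β N τ : ℝ) (p : ι) (t h : ι → ℝ) : Prop :=
  ENNReal.ofReal τ < ENNReal.ofReal (t p ^ (-β) * h p) /
    (ENNReal.ofReal N + ∑' q : {q // q ≠ p}, ENNReal.ofReal (t q ^ (-β) * h q))

/-- The conditional probability given the locations that transmitter `p` has signal to
interference plus noise ratio above `τ`. -/
def exceedProb (β N τ : ℝ) (p : ι) (t : ι → ℝ) : ℝ≥0∞ :=
  expNeg (ENNReal.ofReal (τ * N * t p ^ β) +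
    ∑' q : {q // q ≠ p}, ENNReal.ofReal (Real.log (1 + τ * (t p / t q) ^ β)))

/-- Clearing the denominator and multiplying by `t p ^ β` isolates the fading of `p`, in the form
treated by `measure_add_tsum_lt`. -/
lemma exceedsSinr_iff {β N τ : ℝ} (hτ : 0 < τ) {p : ι} {t : ι → ℝ}
    (ht : ∀ q, 0 ≤ t q) (htp : 0 < t p) (h : ι → ℝ) :
    ExceedsSinr β N τ p t h ↔ ENNReal.ofReal (τ * N * t p ^ β) +
      ∑' q : {q // q ≠ p}, ((τ * (t p / t q) ^ β).toNNReal : ℝ≥0∞) * ENNReal.ofReal (h q) <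
        ENNReal.ofReal (h p) := by
  have hp : 0 < t p ^ β := Real.rpow_pos_of_pos htp β
  have hpp : ENNReal.ofReal (t p ^ β) ≠ 0 := by simpa using hp
  have hterm : ∀ q, ((τ * (t p / t q) ^ β).toNNReal : ℝ≥0∞) * ENNReal.ofReal (h q) =
      ENNReal.ofReal (t p ^ β) *
        (ENNReal.ofReal τ * ENNReal.ofReal (t q ^ (-β) * h q)) := by
    intro q
    have h1 : τ * (t p / t q) ^ β = t p ^ β * (τ * t q ^ (-β)) := by
      rw [Real.div_rpow htp.le (ht q), Real.rpow_neg (ht q)]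
      ring
    have hq : 0 ≤ t q ^ (-β) := Real.rpow_nonneg (ht q) _
    change ENNReal.ofReal _ * _ = _
    rw [h1, ENNReal.ofReal_mul hp.le, ENNReal.ofReal_mul hτ.le, ENNReal.ofReal_mul hq]
    ring
  have hnoise : ENNReal.ofReal (τ * N * t p ^ β) =
      ENNReal.ofReal (t p ^ β) * (ENNReal.ofReal τ * ENNReal.ofReal N) := by
    rw [← ENNReal.ofReal_mul hτ.le, ← ENNReal.ofReal_mul hp.le]
    ring_nf
  have hrhs : ENNReal.ofReal (h p) =
      ENNReal.ofReal (t p ^ β) * ENNReal.ofReal (t p ^ (-β) * h p) := by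
    rw [← ENNReal.ofReal_mul hp.le, ← mul_assoc, Real.rpow_neg htp.le,
      mul_inv_cancel₀ hp.ne', one_mul]
  simp_rw [hterm]
  rw [hnoise, hrhs, ENNReal.tsum_mul_left, ENNReal.tsum_mul_left, ← mul_add, ← mul_add,
    ENNReal.mul_lt_mul_iff_right hpp ENNReal.ofReal_ne_top, ExceedsSinr]
  generalize (ENNReal.ofReal N + ∑' q : {q // q ≠ p}, ENNReal.ofReal (t q ^ (-β) * h q)) = D
  have hτ0 : ENNReal.ofReal τ ≠ 0 := by simpa using hτ
  -- The quotient and product forms agree also in the degenerate cases: for `D = 0` both say that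
  -- the signal is nonzero (as `0 / 0 = 0`), and for `D = ∞` both fail.
  rcases eq_or_ne D 0 with rfl | h0
  · rcases eq_or_ne (ENNReal.ofReal (t p ^ (-β) * h p)) 0 with h1 | h1
    · rw [h1]; simp
    · rw [ENNReal.div_zero h1]
      simpa [pos_iff_ne_zero] using h1
  rcases eq_or_ne D ∞ with rfl | hD
  · simp [hτ0]
  · exact ENNReal.lt_div_iff_mul_lt (Or.inl h0) (Or.inl hD)

variable {Ω : Type*} [MeasurableSpace Ω] [Countable ι] {μ : Measure Ω} [IsProbabilityMeasure μ]
  {T H : ι → Ω → ℝ}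

lemma measurableSet_exceedsSinr (β N τ : ℝ) (p : ι) :
    MeasurableSet {x : (ι → ℝ) × (ι → ℝ) | ExceedsSinr β N τ p x.1 x.2} := by
  have h : ∀ q : ι, Measurable fun x : (ι → ℝ) × (ι → ℝ) =>
      ENNReal.ofReal (x.1 q ^ (-β) * x.2 q) := fun q => by fun_prop
  exact measurableSet_lt measurable_const
    ((h p).div (Measurable.const_add (Measurable.tsum fun q : {q // q ≠ p} => h q) _))

lemma measure_exceedsSinr (hm : ∀ p, Measurable (H p)) (hl : ∀ p, μ.map (H p) = expMeasure 1)
    (hi : iIndepFun H μ) {β N τ : ℝ} (hτ : 0 < τ) {p : ι} {t : ι → ℝ}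
    (ht : ∀ q, 0 ≤ t q) (htp : 0 < t p) :
    μ {ω | ExceedsSinr β N τ p t fun q => H q ω} = exceedProb β N τ p t := by
  simp_rw [exceedsSinr_iff hτ ht htp]
  rw [measure_add_tsum_lt hm hl hi, exceedProb]
  congr 3
  ext q
  have : 0 ≤ τ * (t p / t q) ^ β := by
    have := ht q
    positivity
  rw [Real.coe_toNNReal _ this]

/-- The probability of a location event together with the coverage condition. -/
theorem measure_inter_exceedsSinr (hTm : ∀ p, Measurable (T p)) (hm : ∀ p, Measurable (H p))
    (hl : ∀ p, μ.map (H p) = expMeasure 1) (hi : iIndepFun H μ)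
    (hTH : IndepFun (fun ω p => T p ω) (fun ω p => H p ω) μ)
    {β N τ : ℝ} (hτ : 0 < τ) {p : ι} {Q : Set (ι → ℝ)}
    (hQ : MeasurableSet Q) (hQp : ∀ t ∈ Q, (∀ q, 0 ≤ t q) ∧ 0 < t p) :
    μ {ω | (fun q => T q ω) ∈ Q ∧ ExceedsSinr β N τ p (fun q => T q ω) fun q => H q ω} =
      ∫⁻ ω, Q.indicator (exceedProb β N τ p) (fun q => T q ω) ∂μ := by
  have h1 := measure_indepFun_eq_lintegral hTH (measurable_pi_lambda _ hTm)
    (measurable_pi_lambda _ hm)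
    ((measurable_fst hQ).inter (measurableSet_exceedsSinr β N τ p))
  refine h1.trans (lintegral_congr fun ω => ?_)
  by_cases hω : (fun q => T q ω) ∈ Q
  · rw [Set.indicator_of_mem hω, ← measure_exceedsSinr hm hl hi hτ (hQp _ hω).1 (hQp _ hω).2]
    simp [hω]
  · rw [Set.indicator_of_notMem hω]
    simp [hω]

end Coverage

/-! ### Loss exponents and Poisson processes on the half line -/

/-- Loss exponent of a transmitter at normalized squared distance `t` when the serving one is at
distance `s`; it is infinite when `t ≤ s`. -/
def lossExponent (β τ s t : ℝ) : ℝ≥0∞ :=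
  if t ≤ s then ∞ else ENNReal.ofReal (Real.log (1 + τ * (s / t) ^ β))

@[fun_prop]
lemma measurable_lossExponent (β τ s : ℝ) : Measurable (lossExponent β τ s) :=
  Measurable.ite measurableSet_Iic measurable_const (by fun_prop)

lemma lossExponent_le {β τ s t u : ℝ} (hβ : 0 < β) (hτ : 0 < τ) (hs : 0 ≤ s) (hst : s < t)
    (htu : t ≤ u) :
    lossExponent β τ s u ≤ ENNReal.ofReal (Real.log (1 + τ * (t / u) ^ β)) := by
  rw [lossExponent, if_neg (by linarith)]
  have hu : 0 < u := by linarith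
  have h1 : 0 ≤ s / u := by positivity
  refine ENNReal.ofReal_le_ofReal (Real.log_le_log (by positivity) ?_)
  gcongr

lemma le_lossExponent {β τ s t u : ℝ} (hβ : 0 < β) (hτ : 0 < τ) (ht : 0 ≤ t) (hts : t ≤ s)
    (hu : 0 ≤ u) :
    ENNReal.ofReal (Real.log (1 + τ * (t / u) ^ β)) ≤ lossExponent β τ s u := by
  rw [lossExponent]
  split_ifs with h
  · exact le_top
  have h1 : 0 ≤ t / u := by positivity
  refine ENNReal.ofReal_le_ofReal (Real.log_le_log (by positivity) ?_)
  gcongr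

/-- The measure of constant density `ℓ` on the half line. -/
def halfLineMeasure (ℓ : ℝ) : Measure ℝ := ENNReal.ofReal ℓ • volume.restrict (Set.Ici 0)

instance (ℓ : ℝ) : SigmaFinite (halfLineMeasure ℓ) :=
  inferInstanceAs (SigmaFinite (ℓ.toNNReal • volume.restrict (Set.Ici (0 : ℝ))))

lemma halfLineMeasure_Ioc (ℓ : ℝ) {s s' : ℝ} (hs : 0 ≤ s) :
    halfLineMeasure ℓ (Set.Ioc s s') = ENNReal.ofReal ℓ * ENNReal.ofReal (s' - s) := by
  have hsub : Set.Ioc s s' ⊆ Set.Ici 0 := fun x hx => hs.trans hx.1.le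
  rw [halfLineMeasure, Measure.smul_apply, Measure.restrict_apply measurableSet_Ioc,
    Set.inter_eq_left.2 hsub, Real.volume_Ioc, smul_eq_mul]

lemma halfLineMeasure_Ioc_ne_top (ℓ : ℝ) {s s' : ℝ} (hs : 0 ≤ s) :
    halfLineMeasure ℓ (Set.Ioc s s') ≠ ∞ := by
  rw [halfLineMeasure_Ioc _ hs]
  exact ENNReal.mul_ne_top ENNReal.ofReal_ne_top ENNReal.ofReal_ne_top

/-- The counting measure of the points of tier `k` in a configuration. -/
def tierPoints {κ : Type*} (t : κ × ℕ → ℝ) (k : κ) : Measure ℝ :=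
  Measure.sum fun n => Measure.dirac (t (k, n))

/-- Independent Poisson processes of constant rates `ℓ k` on the half line, with independent
exponential marks. -/
structure IsPoissonLineNet {Ω κ : Type*} [MeasurableSpace Ω] (μ : Measure Ω) (ℓ : κ → ℝ)
    (T H : κ × ℕ → Ω → ℝ) : Prop where
  nonneg : ∀ p ω, 0 ≤ T p ω
  measurable_location : ∀ p, Measurable (T p)
  measurable_fading : ∀ p, Measurable (H p)
  poisson : ∀ k, IsPoissonPointProcess μ (fun ω => tierPoints (fun p => T p ω) k)
    (halfLineMeasure (ℓ k))
  indep_tiers : iIndepFun (fun k ω => tierPoints (fun p => T p ω) k) μ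
  fading_law : ∀ p, μ.map (H p) = expMeasure 1
  fading_indep : iIndepFun H μ
  indep_location_fading : IndepFun (fun ω p => T p ω) (fun ω p => H p ω) μ

/-- The Laplace functional of independent Poisson processes, jointly with the number of points of
a set in one of them, which are left out of the functional. -/
lemma lintegral_mul_expNeg_of_tier {Ω E κ : Type*} [MeasurableSpace Ω] [MeasurableSpace E]
    [Fintype κ] [DecidableEq κ] {μ : Measure Ω} [IsProbabilityMeasure μ] {Φ : κ → Ω → Measure E}
    {Λ : κ → Measure E}
    [∀ k, SigmaFinite (Λ k)] (hΦ : ∀ k, IsPoissonPointProcess μ (Φ k) (Λ k))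
    (hind : iIndepFun Φ μ) (i : κ) {A : Set E} (hA : MeasurableSet A)
    {f : ℝ≥0∞ → ℝ≥0∞} (hf : Measurable f) (hfΦ : ∫⁻ ω, f (Φ i ω A) ∂μ ≠ ∞)
    {v : E → ℝ≥0∞} (hv : Measurable v) (c : ℝ≥0∞) :
    ∫⁻ ω, f (Φ i ω A) *
        expNeg (c + ∑ k, ∫⁻ x, (if k = i then Aᶜ.indicator v x else v x) ∂(Φ k ω)) ∂μ =
      (∫⁻ ω, f (Φ i ω A) ∂μ) *
        expNeg (c + ∑ k, ∫⁻ x, (1 - expNeg (if k = i then Aᶜ.indicator v x else v x)) ∂(Λ k)) := by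
  have hfk : ∀ k ω, (if k = i then f else 1) (Φ k ω (if k = i then A else ∅)) =
      if k = i then f (Φ i ω A) else 1 := by
    intro k ω
    split_ifs with hk
    · rw [hk]
    · rfl
  have hvm : ∀ k, Measurable fun x => if k = i then Aᶜ.indicator v x else v x := by
    intro k
    split_ifs
    exacts [hv.indicator hA.compl, hv]
  -- Tiers other than `i` get the empty set and the constant `1`, so they omit nothing and
  -- contribute no prefactor.
  have key := lintegral_prod_mul_expNeg hΦ hind (A := fun k => if k = i then A else ∅)
    (fun k => by split_ifs; exacts [hA, MeasurableSet.empty])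
    (f := fun k => if k = i then f else 1)
    (fun k => by split_ifs; exacts [hf, measurable_one])
    (fun k => by
      simp only [hfk]
      split_ifs
      · exact hfΦ
      · simp)
    hvm
    (fun k x hx => by
      split_ifs at hx ⊢
      · exact Set.indicator_of_notMem (Set.notMem_compl_iff.2 hx) v
      · exact absurd hx (Set.notMem_empty x))
  simp only [hfk, Finset.prod_ite_eq', Finset.mem_univ, if_true] at key
  have hprod : ∏ k, ∫⁻ ω, (if k = i then f (Φ i ω A) else 1) ∂μ = ∫⁻ ω, f (Φ i ω A) ∂μ := by
    rw [Finset.prod_eq_single i]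
    · simp
    · intro k _ hk
      simp [hk]
    · simp
  rw [hprod] at key
  simp_rw [expNeg_add]
  calc _ = ∫⁻ ω, expNeg c * (f (Φ i ω A) *
        expNeg (∑ k, ∫⁻ x, (if k = i then Aᶜ.indicator v x else v x) ∂(Φ k ω))) ∂μ :=
        lintegral_congr fun ω => by ring
    _ = _ := by
      rw [lintegral_const_mul' _ _ (expNeg_ne_top c), key]
      ring

/-- The loss exponents, leaving out the points of tier `i` in `A`. -/
def sliceExponent {κ : Type*} [DecidableEq κ] (β τ s : ℝ) (i : κ) (A : Set ℝ) (k : κ) (t : ℝ) :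
    ℝ≥0∞ :=
  if k = i then Aᶜ.indicator (lossExponent β τ s) t else lossExponent β τ s t

lemma sliceExponent_le {κ : Type*} [DecidableEq κ] (β τ s : ℝ) (i : κ) (A : Set ℝ) (k : κ) (t : ℝ) :
    sliceExponent β τ s i A k t ≤ lossExponent β τ s t := by
  rw [sliceExponent]
  split_ifs
  · exact Set.indicator_le_self _ _ _
  · exact le_rfl

lemma sliceExponent_eq_zero {κ : Type*} [DecidableEq κ] (β τ s : ℝ) (i : κ) {A : Set ℝ} {t : ℝ}
    (ht : t ∈ A) : sliceExponent β τ s i A i t = 0 := by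
  rw [sliceExponent, if_pos rfl, Set.indicator_of_notMem (Set.notMem_compl_iff.2 ht)]

lemma sliceExponent_of_not {κ : Type*} [DecidableEq κ] (β τ s : ℝ) {i : κ} {A : Set ℝ} {k : κ}
    {t : ℝ} (h : ¬(k = i ∧ t ∈ A)) : sliceExponent β τ s i A k t = lossExponent β τ s t := by
  rw [sliceExponent]
  split_ifs with hk
  · exact Set.indicator_of_mem (Set.mem_compl fun ht => h ⟨hk, ht⟩) _
  · rfl

lemma measurable_sliceExponent {κ : Type*} [DecidableEq κ] (β τ s : ℝ) (i : κ) {A : Set ℝ}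
    (hA : MeasurableSet A) (k : κ) : Measurable (sliceExponent β τ s i A k) := by
  unfold sliceExponent
  split_ifs
  exacts [(measurable_lossExponent _ _ _).indicator hA.compl, measurable_lossExponent _ _ _]

/-- The exponent of the noise and of the total loss, leaving out the points of tier `i` in `A`. -/
def sliceTotal {κ : Type*} [Fintype κ] [DecidableEq κ] (β N τ s : ℝ) (i : κ) (A : Set ℝ)
    (t : κ × ℕ → ℝ) : ℝ≥0∞ :=
  ENNReal.ofReal (τ * N * s ^ β) + ∑ k, ∫⁻ x, sliceExponent β τ s i A k x ∂(tierPoints t k)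

/-- The conditional coverage probability given that the serving transmitter is at normalized
squared distance `s`, times the probability that no transmitter is closer. -/
def coverageKernel {κ : Type*} [Fintype κ] (β N τ : ℝ) (ℓ : κ → ℝ) (s : ℝ) : ℝ≥0∞ :=
  expNeg (ENNReal.ofReal (τ * N * s ^ β) + ∑ k,
    ENNReal.ofReal (ℓ k) * ∫⁻ t in Set.Ici 0, (1 - expNeg (lossExponent β τ s t)))

/-- Transmitter `p` is at a distance in `(s, s']` and no transmitter is closer. -/
def servingConfig {ι : Type*} (p : ι) (s s' : ℝ) : Set (ι → ℝ) :=
  {t | (∀ q, 0 < t q) ∧ t p ∈ Set.Ioc s s' ∧ ∀ q, t p ≤ t q}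

/-- Transmitter `p` is at a distance in `(s, s']` and all others are farther than `s'`. -/
def isolatedConfig {ι : Type*} (p : ι) (s s' : ℝ) : Set (ι → ℝ) :=
  {t | (∀ q, 0 < t q) ∧ t p ∈ Set.Ioc s s' ∧ ∀ q, q ≠ p → s' < t q}

lemma measurableSet_servingConfig {ι : Type*} [Countable ι] (p : ι) (s s' : ℝ) :
    MeasurableSet (servingConfig p s s') := by
  have h : servingConfig p s s' = (⋂ q, {t | 0 < t q}) ∩ ({t | t p ∈ Set.Ioc s s'} ∩
      ⋂ q, {t | t p ≤ t q}) := by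
    ext t; simp [servingConfig]
  rw [h]
  refine (MeasurableSet.iInter fun q =>
    measurableSet_lt measurable_const (measurable_pi_apply q)).inter
    ((measurable_pi_apply p measurableSet_Ioc).inter (MeasurableSet.iInter fun q =>
      measurableSet_le (measurable_pi_apply p) (measurable_pi_apply q)))

lemma measurableSet_isolatedConfig {ι : Type*} [Countable ι] (p : ι) (s s' : ℝ) :
    MeasurableSet (isolatedConfig p s s') := by
  have h : isolatedConfig p s s' = (⋂ q, {t | 0 < t q}) ∩ ({t | t p ∈ Set.Ioc s s'} ∩
      ⋂ q, ⋂ (_ : q ≠ p), {t | s' < t q}) := by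
    ext t; simp [isolatedConfig]
  rw [h]
  refine (MeasurableSet.iInter fun q =>
    measurableSet_lt measurable_const (measurable_pi_apply q)).inter
    ((measurable_pi_apply p measurableSet_Ioc).inter (MeasurableSet.iInter fun q =>
      MeasurableSet.iInter fun _ => measurableSet_lt measurable_const (measurable_pi_apply q)))

/-! ### Bounds for a fixed configuration -/

section Pathwise

variable {κ : Type*} [Fintype κ] [DecidableEq κ] {β N τ s s' : ℝ} {i : κ} {n : ℕ}
  {t : κ × ℕ → ℝ}

/-- The serving point lies in the omitted set and contributes zero, so the integrals over all points
equal the sum over interferers alone. -/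
lemma sum_lintegral_sliceExponent (β τ s : ℝ) {A : Set ℝ} (hA : MeasurableSet A)
    (ht : t (i, n) ∈ A) :
    ∑ k, ∫⁻ x, sliceExponent β τ s i A k x ∂(tierPoints t k) =
      ∑' q : {q : κ × ℕ // q ≠ (i, n)}, sliceExponent β τ s i A q.1.1 (t q) := by
  have h1 : ∀ k, ∫⁻ x, sliceExponent β τ s i A k x ∂(tierPoints t k) =
      ∑' m, sliceExponent β τ s i A k (t (k, m)) := fun k => by
    rw [tierPoints, lintegral_sum_measure]
    simp_rw [lintegral_dirac' _ (measurable_sliceExponent β τ s i hA k)]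
  simp_rw [h1]
  have h2 := tsum_subtype_eq_of_support_subset
    (f := fun q : κ × ℕ => sliceExponent β τ s i A q.1 (t q)) (s := {q | q ≠ (i, n)})
    (fun q hq hqp => hq (by
      subst hqp
      exact sliceExponent_eq_zero β τ s i ht))
  rw [← tsum_fintype (L := .unconditional κ), ← ENNReal.tsum_prod]
  exact h2.symm

/-- Moving the serving point in to `s` and forgetting the tier `i` interferers in the slice only
lowers the exponent. All points exceed `s`, so no infinite loss occurs. -/
lemma exceedProb_le (hβ : 0 < β) (hN : 0 ≤ N) (hτ : 0 < τ) (hs : 0 ≤ s)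
    (ht : t ∈ servingConfig (i, n) s s') :
    exceedProb β N τ (i, n) t ≤ expNeg (sliceTotal β N τ s i (Set.Ioc s s') t) := by
  obtain ⟨-, htp, hmin⟩ := ht
  rw [sliceTotal, sum_lintegral_sliceExponent β τ s measurableSet_Ioc htp, exceedProb]
  refine expNeg_antitone (add_le_add ?_ (ENNReal.tsum_le_tsum fun q => ?_))
  · have := htp.1.le
    gcongr
  · exact (sliceExponent_le ..).trans (lossExponent_le hβ hτ hs htp.1 (hmin q))

/-- Moving the serving point out to `s'` raises the exponent, and isolation ensures that no
interferer was omitted. -/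
lemma le_exceedProb (hβ : 0 < β) (hN : 0 ≤ N) (hτ : 0 < τ)
    (ht : t ∈ isolatedConfig (i, n) s s') :
    expNeg (sliceTotal β N τ s' i (Set.Ioc s s') t) ≤ exceedProb β N τ (i, n) t := by
  obtain ⟨hpos, htp, hmin⟩ := ht
  rw [sliceTotal, sum_lintegral_sliceExponent β τ s' measurableSet_Ioc htp, exceedProb]
  refine expNeg_antitone (add_le_add ?_ (ENNReal.tsum_le_tsum fun q => ?_))
  · have := hpos (i, n)
    have := htp.2
    gcongr
  · rw [sliceExponent_of_not _ _ _ fun h => (hmin q q.2).not_ge h.2.2]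
    exact le_lossExponent hβ hτ (hpos _).le htp.2 (hpos _).le

/-- If tier `i` has exactly one point in `(s, s']`, then either the configuration is isolated or
the total loss exponent is infinite. -/
lemma exists_isolatedConfig (hs : 0 ≤ s) (hcard : tierPoints t i (Set.Ioc s s') = 1)
    (hfin : sliceTotal β N τ s' i (Set.Ioc s s') t ≠ ∞) :
    ∃ n, t ∈ isolatedConfig (i, n) s s' := by
  rw [tierPoints, Measure.sum_apply _ measurableSet_Ioc] at hcard
  simp_rw [Measure.dirac_apply' _ measurableSet_Ioc] at hcard
  obtain ⟨n, hn⟩ : ∃ n, t (i, n) ∈ Set.Ioc s s' := by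
    by_contra! h
    simp [Set.indicator_of_notMem (h _)] at hcard
  have huniq : ∀ m, m ≠ n → t (i, m) ∉ Set.Ioc s s' := by
    intro m hmn hm
    -- A second index in the slice would make the count at least `2`, even if the two points
    -- coincide.
    have h2 := ENNReal.sum_le_tsum (f := fun m => (Set.Ioc s s').indicator (1 : ℝ → ℝ≥0∞) (t (i, m)))
      {m, n}
    rw [hcard, Finset.sum_pair hmn, Set.indicator_of_mem hm, Set.indicator_of_mem hn] at h2
    norm_num at h2
  rw [sliceTotal, sum_lintegral_sliceExponent β τ s' measurableSet_Ioc hn] at hfin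
  have hlt : ∀ q, q ≠ (i, n) → s' < t q := by
    intro q hq
    have h1 := ENNReal.ne_top_of_tsum_ne_top (ENNReal.add_ne_top.1 hfin).2 ⟨q, hq⟩
    rw [sliceExponent_of_not] at h1
    · by_contra! hle
      exact h1 (if_pos hle)
    · rintro ⟨h2, h3⟩
      obtain ⟨k, m⟩ := q
      obtain rfl : k = i := h2
      exact huniq m (fun h => hq (by rw [h])) h3
  refine ⟨n, fun q => ?_, hn, hlt⟩
  rcases eq_or_ne q (i, n) with rfl | hq
  · exact hs.trans_lt hn.1
  · exact (hs.trans_lt (hn.1.trans_le hn.2)).trans (hlt q hq)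

end Pathwise

/-! ### Restoring the omitted slice in the kernel -/

section Kernel

variable {κ : Type*} [Fintype κ]

lemma coverageKernel_eq (β N τ : ℝ) (ℓ : κ → ℝ) (s : ℝ) :
    coverageKernel β N τ ℓ s = expNeg (ENNReal.ofReal (τ * N * s ^ β) +
      ∑ k, ∫⁻ t, (1 - expNeg (lossExponent β τ s t)) ∂(halfLineMeasure (ℓ k))) := by
  simp only [coverageKernel, halfLineMeasure, lintegral_smul_measure, smul_eq_mul]

variable [DecidableEq κ]

lemma sum_lintegral_indicator (ℓ : κ → ℝ) (i : κ) {A : Set ℝ} (hA : MeasurableSet A) :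
    ∑ k, ∫⁻ t, (if k = i then A.indicator 1 t else 0) ∂(halfLineMeasure (ℓ k)) =
      halfLineMeasure (ℓ i) A := by
  rw [Finset.sum_eq_single i]
  · simp [lintegral_indicator_one hA]
  · intro k _ hk
    simp [hk]
  · simp

/-- Since `1 - expNeg` is at most `1`, putting the omitted set back costs at most its intensity in
the exponent. -/
lemma expNeg_sliceExponent_mul_le (β N τ s : ℝ) (ℓ : κ → ℝ) (i : κ) {A : Set ℝ}
    (hA : MeasurableSet A) :
    expNeg (ENNReal.ofReal (τ * N * s ^ β) +
      ∑ k, ∫⁻ t, (1 - expNeg (sliceExponent β τ s i A k t)) ∂(halfLineMeasure (ℓ k))) *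
        expNeg (halfLineMeasure (ℓ i) A) ≤ coverageKernel β N τ ℓ s := by
  rw [← expNeg_add, coverageKernel_eq, add_assoc]
  refine expNeg_antitone (add_le_add_right ?_ _)
  rw [← sum_lintegral_indicator ℓ i hA, ← Finset.sum_add_distrib]
  refine Finset.sum_le_sum fun k _ => ?_
  have hm : Measurable fun t => 1 - expNeg (sliceExponent β τ s i A k t) :=
    measurable_const.sub (measurable_expNeg.comp (measurable_sliceExponent β τ s i hA k))
  rw [← lintegral_add_left hm]
  refine lintegral_mono fun t => ?_
  by_cases h : k = i ∧ t ∈ A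
  · rw [if_pos h.1, Set.indicator_of_mem h.2]
    exact tsub_le_self.trans le_add_self
  · rw [sliceExponent_of_not _ _ _ h]
    exact le_self_add

/-- Relative to `s'` the loss is infinite on the slice, so the omitted integrand is exactly `1`
there and the void factor of the slice accounts for it. -/
lemma coverageKernel_le_expNeg_sliceExponent (β N τ : ℝ) (ℓ : κ → ℝ) (i : κ) (s s' : ℝ) :
    coverageKernel β N τ ℓ s' ≤ expNeg (ENNReal.ofReal (τ * N * s' ^ β) +
      ∑ k, ∫⁻ t, (1 - expNeg (sliceExponent β τ s' i (Set.Ioc s s') k t))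
        ∂(halfLineMeasure (ℓ k))) * expNeg (halfLineMeasure (ℓ i) (Set.Ioc s s')) := by
  rw [← expNeg_add, coverageKernel_eq, add_assoc]
  refine expNeg_antitone (add_le_add_right ?_ _)
  rw [← sum_lintegral_indicator ℓ i measurableSet_Ioc, ← Finset.sum_add_distrib]
  refine Finset.sum_le_sum fun k _ => ?_
  have hm : Measurable fun t => 1 - expNeg (sliceExponent β τ s' i (Set.Ioc s s') k t) :=
    measurable_const.sub
      (measurable_expNeg.comp (measurable_sliceExponent β τ s' i measurableSet_Ioc k))
  rw [← lintegral_add_left hm]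
  refine lintegral_mono fun t => ?_
  by_cases h : k = i ∧ t ∈ Set.Ioc s s'
  · obtain ⟨rfl, ht⟩ := h
    rw [sliceExponent_eq_zero _ _ _ _ ht, lossExponent, if_pos ht.2]
    simp [Set.indicator_of_mem ht]
  · rw [sliceExponent_of_not _ _ _ h]
    have : (if k = i then (Set.Ioc s s').indicator (1 : ℝ → ℝ≥0∞) t else 0) = 0 := by
      split_ifs with hk
      · exact Set.indicator_of_notMem (fun ht => h ⟨hk, ht⟩) _
      · rfl
    rw [this, add_zero]

end Kernel

/-! ### Probability bounds for one slice -/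

namespace IsPoissonLineNet

variable {Ω κ : Type*} [MeasurableSpace Ω] [Fintype κ] {μ : Measure Ω}
  {ℓ : κ → ℝ} {T H : κ × ℕ → Ω → ℝ} {β N τ s s' : ℝ}

/-- The origin has intensity zero. It must be excluded because `0 ^ (-β) = 0` would rank a station
there as the weakest. -/
lemma ae_pos (hnet : IsPoissonLineNet μ ℓ T H) : ∀ᵐ ω ∂μ, ∀ p, 0 < T p ω := by
  rw [ae_all_iff]
  rintro ⟨k, n⟩
  have h0 : halfLineMeasure (ℓ k) {0} = 0 := by simp [halfLineMeasure]
  have h1 := (hnet.poisson k).lintegral_apply (measurableSet_singleton 0)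
    (by rw [h0]; simp)
  rw [h0,
    lintegral_eq_zero_iff ((hnet.poisson k).measurable_apply (measurableSet_singleton 0))] at h1
  filter_upwards [h1] with ω hω
  refine lt_of_le_of_ne (hnet.nonneg _ _) fun h => ?_
  rw [Pi.zero_apply, tierPoints, Measure.sum_apply _ (measurableSet_singleton 0),
    ENNReal.tsum_eq_zero] at hω
  simpa [← h] using hω n

/-- The event that the locations are in `Q` and transmitter `p` exceeds the threshold. -/
def event (β N τ : ℝ) (T H : κ × ℕ → Ω → ℝ) (p : κ × ℕ) (Q : Set (κ × ℕ → ℝ)) : Set Ω :=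
  {ω | (fun q => T q ω) ∈ Q ∧ ExceedsSinr β N τ p (fun q => T q ω) fun q => H q ω}

lemma measurableSet_event (hnet : IsPoissonLineNet μ ℓ T H) (p : κ × ℕ)
    {Q : Set (κ × ℕ → ℝ)} (hQ : MeasurableSet Q) : MeasurableSet (event β N τ T H p Q) :=
  ((measurable_pi_lambda _ hnet.measurable_location).prodMk
    (measurable_pi_lambda _ hnet.measurable_fading))
    ((measurable_fst hQ).inter (measurableSet_exceedsSinr β N τ p))

lemma measurable_sliceTotal [DecidableEq κ] (hnet : IsPoissonLineNet μ ℓ T H) (i : κ)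
    {A : Set ℝ} (hA : MeasurableSet A) :
    Measurable fun ω => sliceTotal β N τ s i A (fun q => T q ω) :=
  Measurable.const_add (Finset.measurable_fun_sum _ fun k _ =>
    (Measure.measurable_lintegral (measurable_sliceExponent β τ s i hA k)).comp
      (hnet.poisson k).measurable) _

lemma measurable_indicator_exceedProb (hnet : IsPoissonLineNet μ ℓ T H) (β N τ : ℝ) (p : κ × ℕ)
    {Q : Set (κ × ℕ → ℝ)} (hQ : MeasurableSet Q) :
    Measurable fun ω => Q.indicator (exceedProb β N τ p) (fun q => T q ω) := by
  have h1 : Measurable fun t : κ × ℕ → ℝ => ENNReal.ofReal (τ * N * t p ^ β) := by fun_prop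
  have h2 : ∀ q, Measurable fun t : κ × ℕ → ℝ =>
      ENNReal.ofReal (Real.log (1 + τ * (t p / t q) ^ β)) := fun q => by fun_prop
  have h3 : Measurable fun t : κ × ℕ → ℝ => ∑' q : {q // q ≠ p},
      ENNReal.ofReal (Real.log (1 + τ * (t p / t q) ^ β)) := Measurable.tsum fun q => h2 q
  exact ((measurable_expNeg.comp (h1.add h3)).indicator hQ).comp
    (measurable_pi_lambda _ hnet.measurable_location)

variable [IsProbabilityMeasure μ]

lemma measure_event (hnet : IsPoissonLineNet μ ℓ T H) (hτ : 0 < τ) (p : κ × ℕ)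
    {Q : Set (κ × ℕ → ℝ)} (hQ : MeasurableSet Q) (hpos : ∀ t ∈ Q, ∀ q, 0 < t q) :
    μ (event β N τ T H p Q) = ∫⁻ ω, Q.indicator (exceedProb β N τ p) (fun q => T q ω) ∂μ :=
  measure_inter_exceedsSinr hnet.measurable_location hnet.measurable_fading hnet.fading_law
    hnet.fading_indep hnet.indep_location_fading hτ hQ
    fun t ht => ⟨fun q => (hpos t ht q).le, hpos t ht p⟩

lemma lintegral_mul_expNeg_sliceTotal [DecidableEq κ] (hnet : IsPoissonLineNet μ ℓ T H) (i : κ)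
    {A : Set ℝ} (hA : MeasurableSet A) {f : ℝ≥0∞ → ℝ≥0∞} (hf : Measurable f)
    (hfΦ : ∫⁻ ω, f (tierPoints (fun q => T q ω) i A) ∂μ ≠ ∞) :
    ∫⁻ ω, f (tierPoints (fun q => T q ω) i A) *
        expNeg (sliceTotal β N τ s i A fun q => T q ω) ∂μ =
      (∫⁻ ω, f (tierPoints (fun q => T q ω) i A) ∂μ) *
        expNeg (ENNReal.ofReal (τ * N * s ^ β) +
          ∑ k, ∫⁻ x, (1 - expNeg (sliceExponent β τ s i A k x)) ∂(halfLineMeasure (ℓ k))) :=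
  lintegral_mul_expNeg_of_tier (Λ := fun k => halfLineMeasure (ℓ k)) hnet.poisson
    hnet.indep_tiers i hA hf hfΦ (measurable_lossExponent β τ s) _

/-- At most as many indices serve from the slice as tier `i` has points in it. That count has mean
equal to the intensity and factors out of the reduced Laplace functional; the void factor on the
left pays for the omitted points. -/
lemma tsum_measure_serving_mul_le (hnet : IsPoissonLineNet μ ℓ T H) (hβ : 0 < β) (hN : 0 ≤ N)
    (hτ : 0 < τ) (hs : 0 ≤ s) (i : κ) :
    (∑' n, μ (event β N τ T H (i, n) (servingConfig (i, n) s s'))) *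
        expNeg (halfLineMeasure (ℓ i) (Set.Ioc s s')) ≤
      halfLineMeasure (ℓ i) (Set.Ioc s s') * coverageKernel β N τ ℓ s := by
  classical
  have hΛ := halfLineMeasure_Ioc_ne_top (ℓ i) (s' := s') hs
  have hmean := (hnet.poisson i).lintegral_apply measurableSet_Ioc hΛ
  have key := hnet.lintegral_mul_expNeg_sliceTotal (β := β) (N := N) (τ := τ) (s := s) i
    (measurableSet_Ioc (a := s) (b := s')) measurable_id
    (by simpa only [id] using hmean.trans_ne hΛ)
  simp only [id] at key
  rw [hmean] at key
  have hm : ∀ n, AEMeasurable (fun ω => (servingConfig (i, n) s s').indicator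
      (fun _ => expNeg (sliceTotal β N τ s i (Set.Ioc s s') fun q => T q ω))
      (fun q => T q ω)) μ := by
    intro n
    exact ((measurable_expNeg.comp (hnet.measurable_sliceTotal i measurableSet_Ioc)).indicator
      (measurable_pi_lambda _ hnet.measurable_location
        (measurableSet_servingConfig (i, n) s s'))).aemeasurable
  have hle : ∑' n, μ (event β N τ T H (i, n) (servingConfig (i, n) s s')) ≤
      ∫⁻ ω, tierPoints (fun q => T q ω) i (Set.Ioc s s') *
        expNeg (sliceTotal β N τ s i (Set.Ioc s s') fun q => T q ω) ∂μ := by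
    refine (ENNReal.tsum_le_tsum fun n => ?_).trans ((lintegral_tsum hm).symm.trans_le ?_)
    · rw [hnet.measure_event hτ _ (measurableSet_servingConfig _ _ _) fun t ht => ht.1]
      refine lintegral_mono fun ω => ?_
      by_cases h : (fun q => T q ω) ∈ servingConfig (i, n) s s'
      · rw [Set.indicator_of_mem h, Set.indicator_of_mem h]
        exact exceedProb_le hβ hN hτ hs h
      · rw [Set.indicator_of_notMem h, Set.indicator_of_notMem h]
    · refine lintegral_mono fun ω => ?_
      rw [tierPoints, Measure.sum_apply _ measurableSet_Ioc, ← ENNReal.tsum_mul_right]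
      refine ENNReal.tsum_le_tsum fun n => ?_
      by_cases h : (fun q => T q ω) ∈ servingConfig (i, n) s s'
      · rw [Set.indicator_of_mem h, Measure.dirac_apply_of_mem h.2.1, one_mul]
      · rw [Set.indicator_of_notMem h]
        exact zero_le
  rw [key] at hle
  refine (mul_le_mul_left hle _).trans ?_
  rw [mul_assoc]
  exact mul_le_mul_right (expNeg_sliceExponent_mul_le β N τ s ℓ i measurableSet_Ioc) _

/-- Here the count enters through the indicator of the value `1`, whose mean `Λ * expNeg Λ` carries
the void factor needed to complete the kernel. Configurations with another station up to `s'` have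
infinite loss and drop out. -/
lemma mul_coverageKernel_le_tsum_measure_isolated (hnet : IsPoissonLineNet μ ℓ T H) (hβ : 0 < β)
    (hN : 0 ≤ N) (hτ : 0 < τ) (hs : 0 ≤ s) (i : κ) :
    halfLineMeasure (ℓ i) (Set.Ioc s s') * coverageKernel β N τ ℓ s' ≤
      ∑' n, μ (event β N τ T H (i, n) (isolatedConfig (i, n) s s')) := by
  classical
  have hΛ := halfLineMeasure_Ioc_ne_top (ℓ i) (s' := s') hs
  have hone := (hnet.poisson i).lintegral_apply_eq_one measurableSet_Ioc hΛ
  have key := hnet.lintegral_mul_expNeg_sliceTotal (β := β) (N := N) (τ := τ) (s := s') i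
    (measurableSet_Ioc (a := s) (b := s'))
    (measurable_one.indicator (measurableSet_singleton (1 : ℝ≥0∞)))
    (hone.trans_ne (ENNReal.mul_ne_top hΛ (expNeg_ne_top _)))
  rw [hone] at key
  have hge : ∫⁻ ω, Set.indicator {1} 1 (tierPoints (fun q => T q ω) i (Set.Ioc s s')) *
      expNeg (sliceTotal β N τ s' i (Set.Ioc s s') fun q => T q ω) ∂μ ≤
      ∑' n, μ (event β N τ T H (i, n) (isolatedConfig (i, n) s s')) := by
    have hsum : ∑' n, μ (event β N τ T H (i, n) (isolatedConfig (i, n) s s')) =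
        ∫⁻ ω, ∑' n, (isolatedConfig (i, n) s s').indicator (exceedProb β N τ (i, n))
          (fun q => T q ω) ∂μ := by
      rw [lintegral_tsum fun n => (hnet.measurable_indicator_exceedProb β N τ (i, n)
        (measurableSet_isolatedConfig _ _ _)).aemeasurable]
      exact tsum_congr fun n =>
        hnet.measure_event hτ _ (measurableSet_isolatedConfig _ _ _) fun t ht => ht.1
    rw [hsum]
    refine lintegral_mono fun ω => ?_
    by_cases hcard : tierPoints (fun q => T q ω) i (Set.Ioc s s') = 1
    swap
    · rw [Set.indicator_of_notMem (by simpa using hcard), zero_mul]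
      exact zero_le
    rw [Set.indicator_of_mem (by simpa using hcard), Pi.one_apply, one_mul]
    by_cases hfin : sliceTotal β N τ s' i (Set.Ioc s s') (fun q => T q ω) = ∞
    · rw [hfin, expNeg_top]
      exact zero_le
    obtain ⟨n, hn⟩ := exists_isolatedConfig (t := fun q => T q ω) hs hcard hfin
    refine le_trans ?_ (ENNReal.le_tsum n)
    rw [Set.indicator_of_mem hn]
    exact le_exceedProb hβ hN hτ hn
  rw [key] at hge
  refine le_trans ?_ hge
  rw [mul_assoc, mul_comm (expNeg (halfLineMeasure _ _))]
  exact mul_le_mul_right (coverageKernel_le_expNeg_sliceExponent β N τ ℓ i s s') _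

end IsPoissonLineNet

/-! ### Monotonicity of the kernel and Riemann sums -/

lemma lossExponent_mono {β τ s s' : ℝ} (hβ : 0 < β) (hτ : 0 < τ) (hs : 0 ≤ s) (hss : s ≤ s')
    (t : ℝ) : lossExponent β τ s t ≤ lossExponent β τ s' t := by
  rw [lossExponent]
  split_ifs with h
  · rw [lossExponent, if_pos (h.trans hss)]
  · exact le_lossExponent hβ hτ hs hss (by linarith)

lemma coverageKernel_antitone {κ : Type*} [Fintype κ] {β N τ s s' : ℝ} (ℓ : κ → ℝ) (hβ : 0 < β)
    (hN : 0 ≤ N) (hτ : 0 < τ) (hs : 0 ≤ s) (hss : s ≤ s') :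
    coverageKernel β N τ ℓ s' ≤ coverageKernel β N τ ℓ s := by
  refine expNeg_antitone (add_le_add ?_ (Finset.sum_le_sum fun k _ => mul_le_mul_right
    (lintegral_mono fun t => tsub_le_tsub_left (expNeg_antitone ?_) _) _))
  · gcongr
  · exact lossExponent_mono hβ hτ hs hss t

lemma iUnion_Ioc_nat_mul {δ : ℝ} (hδ : 0 < δ) :
    ⋃ k : ℕ, Set.Ioc (k * δ) ((k + 1) * δ) = Set.Ioi 0 := by
  ext x
  simp only [Set.mem_iUnion, Set.mem_Ioc, Set.mem_Ioi]
  constructor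
  · rintro ⟨k, hk, -⟩
    exact lt_of_le_of_lt (by positivity) hk
  · intro hx
    have h1 : 0 < ⌈x / δ⌉₊ := Nat.ceil_pos.2 (by positivity)
    obtain ⟨k, hk⟩ : ∃ k, ⌈x / δ⌉₊ = k + 1 := ⟨_, (Nat.succ_pred_eq_of_pos h1).symm⟩
    refine ⟨k, ?_, ?_⟩
    · rw [← lt_div_iff₀ hδ]
      exact Nat.lt_ceil.1 (by omega)
    · rw [← div_le_iff₀ hδ]
      have := Nat.le_ceil (x / δ)
      rw [hk] at this
      exact_mod_cast this

lemma pairwise_disjoint_Ioc_nat_mul {δ : ℝ} (hδ : 0 < δ) :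
    Pairwise fun j k : ℕ => Disjoint (Set.Ioc (j * δ) ((j + 1) * δ))
      (Set.Ioc (k * δ) ((k + 1) * δ)) := by
  have key : ∀ j k : ℕ, j < k → Disjoint (Set.Ioc (j * δ) ((j + 1) * δ))
      (Set.Ioc (k * δ) ((k + 1) * δ)) := by
    intro j k hjk
    refine Set.disjoint_left.2 fun x hx hx' => ?_
    have h1 : (j + 1 : ℝ) ≤ k := by exact_mod_cast hjk
    have h2 := mul_le_mul_of_nonneg_right h1 hδ.le
    linarith [hx.2, hx'.1]
  intro j k hjk
  rcases lt_or_gt_of_ne hjk with h | h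
  · exact key j k h
  · exact (key k j h).symm

lemma lintegral_Ioi_eq_tsum {δ : ℝ} (hδ : 0 < δ) (f : ℝ → ℝ≥0∞) :
    ∫⁻ s in Set.Ioi 0, f s = ∑' k : ℕ, ∫⁻ s in Set.Ioc (k * δ) ((k + 1) * δ), f s := by
  rw [← iUnion_Ioc_nat_mul hδ, lintegral_iUnion (fun _ => measurableSet_Ioc)
    (pairwise_disjoint_Ioc_nat_mul hδ)]

section RiemannSum

variable {f : ℝ → ℝ≥0∞} {δ : ℝ}

lemma volume_Ioc_nat_mul (δ : ℝ) (k : ℕ) :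
    volume (Set.Ioc (k * δ) ((k + 1) * δ)) = ENNReal.ofReal δ := by
  rw [Real.volume_Ioc]
  congr 1
  ring

lemma tsum_mul_le_lintegral (hδ : 0 < δ) (hf : AntitoneOn f (Set.Ici 0)) :
    ∑' k : ℕ, ENNReal.ofReal δ * f ((k + 1) * δ) ≤ ∫⁻ s in Set.Ioi 0, f s := by
  rw [lintegral_Ioi_eq_tsum hδ]
  refine ENNReal.tsum_le_tsum fun k => ?_
  rw [← volume_Ioc_nat_mul δ k, mul_comm (volume _), ← setLIntegral_const]
  refine setLIntegral_mono' measurableSet_Ioc fun s hs => ?_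
  have h0 : (0 : ℝ) ≤ k * δ := by positivity
  exact hf (h0.trans hs.1.le) (h0.trans (hs.1.le.trans hs.2)) hs.2

lemma lintegral_le_tsum_mul (hδ : 0 < δ) (hf : AntitoneOn f (Set.Ici 0)) :
    ∫⁻ s in Set.Ioi 0, f s ≤ ∑' k : ℕ, ENNReal.ofReal δ * f (k * δ) := by
  rw [lintegral_Ioi_eq_tsum hδ]
  refine ENNReal.tsum_le_tsum fun k => ?_
  rw [← volume_Ioc_nat_mul δ k, mul_comm (volume _), ← setLIntegral_const]
  refine setLIntegral_mono' measurableSet_Ioc fun s hs => ?_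
  have h0 : (0 : ℝ) ≤ k * δ := by positivity
  exact hf h0 (h0.trans hs.1.le) hs.1.le

/-- The left-endpoint and right-endpoint sums differ by the single term at `0`, so the squeeze has
width at most `δ`. -/
lemma tsum_mul_le_add_tsum (hf1 : f 0 ≤ 1) (δ : ℝ) :
    ∑' k : ℕ, ENNReal.ofReal δ * f (k * δ) ≤
      ENNReal.ofReal δ + ∑' k : ℕ, ENNReal.ofReal δ * f ((k + 1) * δ) := by
  rw [tsum_eq_zero_add' ENNReal.summable]
  push_cast
  refine add_le_add ?_ le_rfl
  rw [zero_mul]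
  exact mul_le_of_le_one_right' hf1

lemma halfLineMeasure_slice (ℓ : ℝ) {δ : ℝ} (hδ : 0 < δ) (k : ℕ) :
    halfLineMeasure ℓ (Set.Ioc (k * δ) ((k + 1) * δ)) =
      ENNReal.ofReal ℓ * ENNReal.ofReal δ := by
  rw [halfLineMeasure_Ioc _ (by positivity)]
  congr 2
  ring

end RiemannSum

/-! ### Coverage probability as an integral over the half line -/

namespace IsPoissonLineNet

variable {Ω κ : Type*} [MeasurableSpace Ω] [Fintype κ] {μ : Measure Ω} [IsProbabilityMeasure μ]
  {ℓ τ : κ → ℝ} {T H : κ × ℕ → Ω → ℝ} {β N δ : ℝ}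

/-- The coverage event in terms of normalized squared distances. -/
def coverage (β N : ℝ) (τ : κ → ℝ) (T H : κ × ℕ → Ω → ℝ) : Set Ω :=
  {ω | ∃ p : κ × ℕ, (∀ q, T q ω ^ (-β) ≤ T p ω ^ (-β)) ∧
    ExceedsSinr β N (τ p.1) p (fun q => T q ω) fun q => H q ω}

/-- A union bound suffices, so ties between stations need not be excluded. -/
lemma measure_coverage_mul_le (hnet : IsPoissonLineNet μ ℓ T H) (hβ : 0 < β) (hN : 0 ≤ N)
    (hτ : ∀ i, 0 < τ i) (hδ : 0 < δ) :
    μ (coverage β N τ T H) * expNeg ((∑ i, ENNReal.ofReal (ℓ i)) * ENNReal.ofReal δ) ≤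
      ∑ i, ENNReal.ofReal (ℓ i) *
        ∑' k : ℕ, ENNReal.ofReal δ * coverageKernel β N (τ i) ℓ (k * δ) := by
  have hsub : μ (coverage β N τ T H) ≤ μ (⋃ i, ⋃ k : ℕ, ⋃ n, event β N (τ i) T H (i, n)
      (servingConfig (i, n) (k * δ) ((k + 1) * δ))) := by
    refine measure_mono_ae ?_
    filter_upwards [hnet.ae_pos] with ω hω
    rintro ⟨⟨i, n⟩, hserv, hex⟩
    have hp : T (i, n) ω ∈ ⋃ k : ℕ, Set.Ioc (k * δ) ((k + 1) * δ) := by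
      rw [iUnion_Ioc_nat_mul hδ]; exact hω _
    obtain ⟨k, hk⟩ := Set.mem_iUnion.1 hp
    refine Set.mem_iUnion.2 ⟨i, Set.mem_iUnion.2 ⟨k, Set.mem_iUnion.2 ⟨n, ⟨hω, hk, fun q => ?_⟩,
      hex⟩⟩⟩
    by_contra! hlt
    exact (hserv q).not_gt (Real.rpow_lt_rpow_of_neg (hω q) hlt (by linarith))
  have hsum : μ (coverage β N τ T H) ≤ ∑ i, ∑' k : ℕ, ∑' n, μ (event β N (τ i) T H (i, n)
      (servingConfig (i, n) (k * δ) ((k + 1) * δ))) := by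
    refine hsub.trans ((measure_iUnion_le _).trans ?_)
    rw [tsum_fintype]
    refine Finset.sum_le_sum fun i _ => (measure_iUnion_le _).trans ?_
    exact ENNReal.tsum_le_tsum fun k => measure_iUnion_le _
  refine (mul_le_mul_left hsum _).trans ?_
  rw [Finset.sum_mul]
  refine Finset.sum_le_sum fun i _ => ?_
  rw [← ENNReal.tsum_mul_right, ← ENNReal.tsum_mul_left]
  refine ENNReal.tsum_le_tsum fun k => ?_
  have h1 := hnet.tsum_measure_serving_mul_le (s := k * δ) (s' := (k + 1) * δ) hβ hN (hτ i)
    (by positivity) i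
  rw [halfLineMeasure_slice (ℓ i) hδ] at h1
  rw [← mul_assoc]
  -- The void factor of tier `i` is replaced by the smaller one for the total rate, common to all
  -- tiers.
  refine le_trans (mul_le_mul_right (expNeg_antitone ?_) _) h1
  exact mul_le_mul_left (Finset.single_le_sum (f := fun i => ENNReal.ofReal (ℓ i))
    (fun _ _ => zero_le) (Finset.mem_univ i)) _

lemma le_measure_coverage (hnet : IsPoissonLineNet μ ℓ T H) (hβ : 0 < β) (hN : 0 ≤ N)
    (hτ : ∀ i, 0 < τ i) (hδ : 0 < δ) :
    ∑ i, ENNReal.ofReal (ℓ i) *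
        ∑' k : ℕ, ENNReal.ofReal δ * coverageKernel β N (τ i) ℓ ((k + 1) * δ) ≤
      μ (coverage β N τ T H) := by
  let D : (κ × ℕ) × ℕ → Set Ω := fun x => event β N (τ x.1.1) T H x.1
    (isolatedConfig x.1 (x.2 * δ) ((x.2 + 1) * δ))
  have hD : ∀ x, MeasurableSet (D x) := fun x =>
    hnet.measurableSet_event _ (measurableSet_isolatedConfig _ _ _)
  have hdisj : Pairwise (Function.onFun Disjoint D) := by
    rintro ⟨p, j⟩ ⟨q, k⟩ hne
    refine Set.disjoint_left.2 fun ω h1 h2 => hne ?_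
    obtain ⟨⟨-, hp, hp'⟩, -⟩ := h1
    obtain ⟨⟨-, hq, hq'⟩, -⟩ := h2
    -- Two distinct isolated stations would each have to lie beyond the slice containing the other.
    have hpq : p = q := by
      by_contra hpq
      exact lt_irrefl _ ((hp' q (Ne.symm hpq)).trans_le (hq.2.trans ((hq' p hpq).le.trans hp.2)))
    subst hpq
    have hjk : j = k := by
      by_contra hjk
      exact Set.disjoint_left.1 (pairwise_disjoint_Ioc_nat_mul hδ hjk) hp hq
    rw [hjk]
  have hsub : ⋃ x, D x ⊆ coverage β N τ T H := by
    refine Set.iUnion_subset ?_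
    rintro ⟨p, k⟩ ω ⟨⟨hpos, hp, hp'⟩, hex⟩
    refine ⟨p, fun q => ?_, hex⟩
    rcases eq_or_ne q p with rfl | hq
    · exact le_rfl
    · exact Real.rpow_le_rpow_of_nonpos (hpos p) (hp.2.trans (hp' q hq).le) (by linarith)
  refine le_trans ?_ (measure_mono hsub)
  rw [measure_iUnion hdisj hD, ENNReal.tsum_prod', ENNReal.tsum_prod', tsum_fintype]
  refine Finset.sum_le_sum fun i _ => ?_
  rw [ENNReal.tsum_comm, ← ENNReal.tsum_mul_left]
  refine ENNReal.tsum_le_tsum fun k => ?_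
  have h1 := hnet.mul_coverageKernel_le_tsum_measure_isolated (s := k * δ) (s' := (k + 1) * δ)
    hβ hN (hτ i) (by positivity) i
  rwa [halfLineMeasure_slice (ℓ i) hδ, mul_assoc] at h1

/-- The coverage probability as an integral over the normalized squared serving distance. -/
theorem measure_coverage (hnet : IsPoissonLineNet μ ℓ T H) (hβ : 0 < β) (hN : 0 ≤ N)
    (hτ : ∀ i, 0 < τ i) :
    μ (coverage β N τ T H) =
      ∑ i, ENNReal.ofReal (ℓ i) * ∫⁻ s in Set.Ioi 0, coverageKernel β N (τ i) ℓ s := by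
  set R := ∑ i, ENNReal.ofReal (ℓ i) * ∫⁻ s in Set.Ioi 0, coverageKernel β N (τ i) ℓ s with hR
  set L := ∑ i, ENNReal.ofReal (ℓ i) with hL
  have hLtop : L ≠ ∞ := ENNReal.sum_ne_top.2 fun _ _ => ENNReal.ofReal_ne_top
  have hanti : ∀ i, AntitoneOn (coverageKernel β N (τ i) ℓ) (Set.Ici 0) := fun i s hs s' _ hss =>
    coverageKernel_antitone ℓ hβ hN (hτ i) hs hss
  have hone : ∀ i, coverageKernel β N (τ i) ℓ 0 ≤ 1 := fun i => expNeg_le_one _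
  have hsplit : ∀ δ : ℝ, ∀ F : κ → ℝ≥0∞, ∑ i, ENNReal.ofReal (ℓ i) * (ENNReal.ofReal δ + F i) =
      L * ENNReal.ofReal δ + ∑ i, ENNReal.ofReal (ℓ i) * F i := fun δ F => by
    simp_rw [mul_add, Finset.sum_add_distrib, hL, Finset.sum_mul]
  have hup : ∀ δ : ℝ, 0 < δ → μ (coverage β N τ T H) * expNeg (L * ENNReal.ofReal δ) ≤
      L * ENNReal.ofReal δ + R := fun δ hδ => by
    refine (hnet.measure_coverage_mul_le hβ hN hτ hδ).trans ?_
    rw [hR, ← hsplit]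
    refine Finset.sum_le_sum fun i _ => mul_le_mul_right ?_ _
    exact (tsum_mul_le_add_tsum (hone i) δ).trans
      (add_le_add le_rfl (tsum_mul_le_lintegral hδ (hanti i)))
  have hlow : ∀ δ : ℝ, 0 < δ → R ≤ L * ENNReal.ofReal δ + μ (coverage β N τ T H) := fun δ hδ => by
    refine le_trans ?_ (add_le_add le_rfl (hnet.le_measure_coverage hβ hN hτ hδ))
    rw [← hsplit]
    refine Finset.sum_le_sum fun i _ => mul_le_mul_right ?_ _
    exact (lintegral_le_tsum_mul hδ (hanti i)).trans (tsum_mul_le_add_tsum (hone i) δ)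
  have hlim : Tendsto (fun δ : ℝ => L * ENNReal.ofReal δ) (𝓝[>] 0) (𝓝 0) := by
    have h1 : Tendsto (fun δ : ℝ => ENNReal.ofReal δ) (𝓝[>] 0) (𝓝 0) := by
      have := (ENNReal.continuous_ofReal.tendsto 0).mono_left (nhdsWithin_le_nhds (s := Set.Ioi 0))
      simpa using this
    simpa using ENNReal.Tendsto.const_mul h1 (Or.inr hLtop)
  refine le_antisymm ?_ ?_
  · have h1 : Tendsto (fun δ : ℝ => μ (coverage β N τ T H) * expNeg (L * ENNReal.ofReal δ))
        (𝓝[>] 0) (𝓝 (μ (coverage β N τ T H))) := by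
      simpa using ENNReal.Tendsto.const_mul ((continuous_expNeg.tendsto 0).comp hlim)
        (Or.inr (measure_ne_top μ (coverage β N τ T H)))
    have h2 : Tendsto (fun δ : ℝ => L * ENNReal.ofReal δ + R) (𝓝[>] 0) (𝓝 R) := by
      simpa using hlim.add (tendsto_const_nhds (x := R))
    exact le_of_tendsto_of_tendsto h1 h2 (eventually_mem_nhdsWithin.mono hup)
  · have h2 : Tendsto (fun δ : ℝ => L * ENNReal.ofReal δ + μ (coverage β N τ T H)) (𝓝[>] 0)
        (𝓝 (μ (coverage β N τ T H))) := by
      simpa using hlim.add (tendsto_const_nhds (x := μ (coverage β N τ T H)))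
    exact ge_of_tendsto h2 (eventually_mem_nhdsWithin.mono hlow)

end IsPoissonLineNet

/-! ### Evaluation of the kernel through `rho` -/

lemma integrableOn_one_div_one_add_rpow {β c : ℝ} (hβ : 1 < β) (hc : 0 < c) :
    IntegrableOn (fun t : ℝ => 1 / (1 + t ^ β)) (Set.Ioi c) := by
  refine Integrable.mono' (integrableOn_Ioi_rpow_of_lt (a := -β) (by linarith) hc)
    (Measurable.aestronglyMeasurable (by fun_prop)) ?_
  filter_upwards [ae_restrict_mem measurableSet_Ioi] with t ht
  have ht0 : 0 < t := hc.trans ht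
  have h1 : 0 < t ^ β := Real.rpow_pos_of_pos ht0 β
  rw [Real.norm_of_nonneg (by positivity), Real.rpow_neg ht0.le, one_div]
  exact inv_anti₀ h1 (by linarith)

lemma rho_pos {τ : ℝ} (hτ : 0 < τ) (α : ℝ) : 0 < rho τ α := by
  have h : 0 ≤ ∫ t in Set.Ioi (τ ^ (-(2 / α))), 1 / (1 + t ^ (α / 2)) := by
    refine setIntegral_nonneg measurableSet_Ioi fun t ht => ?_
    have ht0 : 0 < t := (Real.rpow_pos_of_pos hτ _).trans ht
    positivity
  rw [rho]
  positivity

lemma one_sub_expNeg_lossExponent {β τ s t : ℝ} (hτ : 0 < τ) (hs : 0 < s) (hst : s < t) :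
    1 - expNeg (lossExponent β τ s t) =
      ENNReal.ofReal (1 / (1 + (t / s) ^ β / τ)) := by
  have ht : 0 < t := hs.trans hst
  have hx : 0 < (s / t) ^ β := by positivity
  have hinv : (t / s) ^ β = ((s / t) ^ β)⁻¹ := by
    rw [← Real.inv_rpow (by positivity), inv_div]
  have h1 : 0 < 1 + τ * (s / t) ^ β := by positivity
  rw [lossExponent, if_neg hst.not_ge, expNeg_ofReal (Real.log_nonneg (by
    have := mul_pos hτ hx
    linarith)), Real.exp_neg, Real.exp_log h1, ← ENNReal.ofReal_one,
    ← ENNReal.ofReal_sub _ (by positivity), hinv]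
  congr 1
  field_simp
  ring

/-- The total loss of a unit rate Poisson process on the half line. -/
lemma lintegral_one_sub_expNeg_lossExponent {α τ s : ℝ} (hα : 2 < α) (hτ : 0 < τ) (hs : 0 < s) :
    ∫⁻ t in Set.Ici 0, (1 - expNeg (lossExponent (α / 2) τ s t)) =
      ENNReal.ofReal (s * rho τ α) := by
  have hsplit : Set.Ici (0 : ℝ) = Set.Icc 0 s ∪ Set.Ioi s := (Set.Icc_union_Ioi_eq_Ici hs.le).symm
  have hdisj : Disjoint (Set.Icc 0 s) (Set.Ioi s) :=
    Set.disjoint_left.2 fun x hx hx' => (hx.2.trans_lt hx').false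
  -- The infinite loss on `[0, s]` produces the leading `1` in `rho`.
  have h1 : ∫⁻ t in Set.Icc 0 s, (1 - expNeg (lossExponent (α / 2) τ s t)) = ENNReal.ofReal s := by
    rw [setLIntegral_congr_fun (g := fun _ => 1) measurableSet_Icc fun t ht => by
      simp [lossExponent, ht.2]]
    simp
  -- Chosen so that `(b * t) ^ (α / 2) = (t / s) ^ (α / 2) / τ`; then `b * s` is the lower limit of
  -- the integral in `rho`.
  let b : ℝ := (s * τ ^ (2 / α))⁻¹
  have hτp : 0 < τ ^ (2 / α) := Real.rpow_pos_of_pos hτ _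
  have hb : 0 < b := by positivity
  have hbs : b * s = τ ^ (-(2 / α)) := by
    simp only [b]
    rw [Real.rpow_neg hτ.le]
    field_simp
  have hcpos : 0 < τ ^ (-(2 / α)) := Real.rpow_pos_of_pos hτ _
  have hint := integrableOn_one_div_one_add_rpow (β := α / 2) (by linarith) hcpos
  have hint' : IntegrableOn (fun t : ℝ => 1 / (1 + (b * t) ^ (α / 2))) (Set.Ioi s) := by
    rw [integrableOn_Ioi_comp_mul_left_iff (fun t : ℝ => 1 / (1 + t ^ (α / 2))) s hb, hbs]
    exact hint
  have h2 : ∫⁻ t in Set.Ioi s, (1 - expNeg (lossExponent (α / 2) τ s t)) =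
      ENNReal.ofReal (s * (τ ^ (2 / α) *
        ∫ t in Set.Ioi (τ ^ (-(2 / α))), 1 / (1 + t ^ (α / 2)))) := by
    have h3 : ∀ t ∈ Set.Ioi s, 1 - expNeg (lossExponent (α / 2) τ s t) =
        ENNReal.ofReal (1 / (1 + (b * t) ^ (α / 2))) := by
      intro t ht
      have ht0 : 0 < t := hs.trans ht
      have hpow : (b * t) ^ (α / 2) = (t / s) ^ (α / 2) / τ := by
        have : b * t = t / s / τ ^ (2 / α) := by
          simp only [b]
          field_simp
        rw [this, Real.div_rpow (by positivity) hτp.le, ← Real.rpow_mul hτ.le]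
        have : 2 / α * (α / 2) = 1 := by field_simp
        rw [this, Real.rpow_one]
      rw [one_sub_expNeg_lossExponent hτ hs ht, hpow]
    rw [setLIntegral_congr_fun measurableSet_Ioi h3,
      ← ofReal_integral_eq_lintegral_ofReal hint']
    · rw [integral_comp_mul_left_Ioi (fun t : ℝ => 1 / (1 + t ^ (α / 2))) s hb, hbs]
      simp only [b, inv_inv, smul_eq_mul]
      rw [mul_assoc]
    · filter_upwards [ae_restrict_mem measurableSet_Ioi] with t ht
      have ht0 : 0 < t := hs.trans ht
      change 0 ≤ 1 / (1 + (b * t) ^ (α / 2))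
      positivity
  have hI : 0 ≤ ∫ t in Set.Ioi (τ ^ (-(2 / α))), 1 / (1 + t ^ (α / 2)) := by
    refine setIntegral_nonneg measurableSet_Ioi fun t ht => ?_
    have ht0 : 0 < t := hcpos.trans ht
    positivity
  rw [hsplit, lintegral_union measurableSet_Ioi hdisj, h1, h2,
    ← ENNReal.ofReal_add hs.le (by positivity), rho]
  congr 1
  ring

/-- The coverage integrand in the normalized squared serving distance `s`, when the total rate of
the transmitters is `L`. -/
def scaledIntegrand (α N τ L s : ℝ) : ℝ :=
  Real.exp (-(τ * N * s ^ (α / 2))) * Real.exp (-(L * rho τ α * s))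

lemma scaledIntegrand_nonneg (α N τ L s : ℝ) : 0 ≤ scaledIntegrand α N τ L s := by
  unfold scaledIntegrand
  positivity

lemma coverageKernel_eq_ofReal {κ : Type*} [Fintype κ] {α N τ s : ℝ} {ℓ : κ → ℝ} (hα : 2 < α)
    (hN : 0 ≤ N) (hτ : 0 < τ) (hℓ : ∀ k, 0 ≤ ℓ k) (hs : 0 < s) :
    coverageKernel (α / 2) N τ ℓ s =
      ENNReal.ofReal (scaledIntegrand α N τ (∑ k, ℓ k) s) := by
  have hρ := rho_pos hτ α
  have hL : 0 ≤ ∑ k, ℓ k := Finset.sum_nonneg fun k _ => hℓ k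
  have h1 : ∑ k, ENNReal.ofReal (ℓ k) *
      ∫⁻ t in Set.Ici 0, (1 - expNeg (lossExponent (α / 2) τ s t)) =
      ENNReal.ofReal ((∑ k, ℓ k) * rho τ α * s) := by
    rw [lintegral_one_sub_expNeg_lossExponent hα hτ hs, ← Finset.sum_mul,
      ← ENNReal.ofReal_sum_of_nonneg fun k _ => hℓ k, ← ENNReal.ofReal_mul hL]
    congr 1
    ring
  rw [coverageKernel, h1, expNeg_add, expNeg_ofReal (by positivity), expNeg_ofReal (by positivity),
    ← ENNReal.ofReal_mul (by positivity), scaledIntegrand]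

lemma integrableOn_scaledIntegrand {α N τ L : ℝ} (hN : 0 ≤ N) (hτ : 0 < τ) (hL : 0 < L) :
    IntegrableOn (scaledIntegrand α N τ L) (Set.Ioi 0) := by
  unfold scaledIntegrand
  have hρ := rho_pos hτ α
  refine Integrable.mono' (exp_neg_integrableOn_Ioi 0 (b := L * rho τ α) (by positivity))
    (by fun_prop) ?_
  filter_upwards [ae_restrict_mem measurableSet_Ioi] with s hs
  have hs0 : 0 < s := hs
  rw [Real.norm_of_nonneg (by positivity), neg_mul]
  refine mul_le_of_le_one_left (by positivity) (Real.exp_le_one_iff.2 ?_)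
  have : 0 ≤ τ * N * s ^ (α / 2) := by positivity
  linarith

/-- The coverage probability as a sum of real integrals over the normalized squared distance. -/
theorem IsPoissonLineNet.measureReal_coverage {Ω κ : Type*} [MeasurableSpace Ω] [Fintype κ]
    {μ : Measure Ω} [IsProbabilityMeasure μ] {ℓ τ : κ → ℝ} {T H : κ × ℕ → Ω → ℝ} {α N : ℝ}
    (hnet : IsPoissonLineNet μ ℓ T H) (hα : 2 < α) (hN : 0 ≤ N) (hτ : ∀ i, 0 < τ i)
    (hℓ : ∀ i, 0 < ℓ i) :
    μ.real (coverage (α / 2) N τ T H) = ∑ i, ℓ i * ∫ s in Set.Ioi 0,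
      scaledIntegrand α N (τ i) (∑ k, ℓ k) s := by
  rw [measureReal_def, hnet.measure_coverage (by linarith) hN hτ]
  have h : ∀ i, ENNReal.ofReal (ℓ i) *
      ∫⁻ s in Set.Ioi 0, coverageKernel (α / 2) N (τ i) ℓ s =
      ENNReal.ofReal (ℓ i * ∫ s in Set.Ioi 0,
        scaledIntegrand α N (τ i) (∑ k, ℓ k) s) := by
    intro i
    have hL : 0 < ∑ k, ℓ k := Finset.sum_pos (fun k _ => hℓ k) ⟨i, Finset.mem_univ i⟩
    rw [ENNReal.ofReal_mul (hℓ i).le, ofReal_integral_eq_lintegral_ofReal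
      (integrableOn_scaledIntegrand hN (hτ i) hL)
      (ae_of_all _ fun s => scaledIntegrand_nonneg _ _ _ _ s)]
    congr 1
    exact setLIntegral_congr_fun measurableSet_Ioi fun s hs =>
      coverageKernel_eq_ofReal hα hN (hτ i) (fun k => (hℓ k).le) hs
  simp_rw [h]
  have hnn : ∀ i, 0 ≤ ℓ i * ∫ s in Set.Ioi 0,
      scaledIntegrand α N (τ i) (∑ k, ℓ k) s := fun i =>
    mul_nonneg (hℓ i).le (integral_nonneg fun s => scaledIntegrand_nonneg _ _ _ _ s)
  rw [← ENNReal.ofReal_sum_of_nonneg fun i _ => hnn i,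
    ENNReal.toReal_ofReal (Finset.sum_nonneg fun i _ => hnn i)]

/-! ### Return to the serving distance -/

section CoverageIntegrand

variable {κ : Type*} [Fintype κ] {α N : ℝ} {lam P τ : κ → ℝ}

lemma rpow_two_mul_coverageIntegrand (hα : 2 < α) (hP : ∀ k, 0 < P k) (i : κ) {r : ℝ}
    (hr : 0 < r) :
    coverageIntegrand α N lam P τ i r = r ^ ((2 : ℝ) - 1) •
      scaledIntegrand α N (τ i) (∑ k, lam k * (Real.pi * P k ^ (2 / α)))
        ((P i ^ (2 / α))⁻¹ * r ^ (2 : ℝ)) := by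
  have hPi : 0 < P i ^ (2 / α) := Real.rpow_pos_of_pos (hP i) _
  have h1 : ((P i ^ (2 / α))⁻¹ * r ^ (2 : ℝ)) ^ (α / 2) = r ^ α / P i := by
    rw [Real.mul_rpow (by positivity) (by positivity), Real.inv_rpow hPi.le,
      ← Real.rpow_mul (hP i).le, ← Real.rpow_mul hr.le]
    have h2 : 2 / α * (α / 2) = 1 := by field_simp
    have h3 : 2 * (α / 2) = α := by ring
    rw [h2, h3, Real.rpow_one]
    field_simp
  have h4 : ∀ j, powerRatio α P j i ^ 2 = P j ^ (2 / α) / P i ^ (2 / α) := by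
    intro j
    rw [powerRatio, ← Real.rpow_natCast, ← Real.rpow_mul (div_pos (hP j) (hP i)).le,
      ← Real.div_rpow (hP j).le (hP i).le]
    congr 1
    push_cast
    ring
  have h5 : (∑ k, lam k * (Real.pi * P k ^ (2 / α))) * rho (τ i) α *
      ((P i ^ (2 / α))⁻¹ * r ^ (2 : ℝ)) =
      Real.pi * r ^ 2 * ∑ j, lam j * powerRatio α P j i ^ 2 * rho (τ i) α := by
    simp_rw [h4]
    rw [Real.rpow_two, Finset.sum_mul, Finset.sum_mul, Finset.mul_sum]
    refine Finset.sum_congr rfl fun j _ => ?_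
    field_simp
  simp only [coverageIntegrand, scaledIntegrand, h1, h5, smul_eq_mul]
  have h6 : r ^ ((2 : ℝ) - 1) = r := by norm_num
  rw [h6, mul_div_assoc]
  ring

lemma integrableOn_coverageIntegrand (hα : 2 < α) (hN : 0 ≤ N) (hlam : ∀ k, 0 < lam k)
    (hP : ∀ k, 0 < P k) (hτ : ∀ k, 0 < τ k) (i : κ) :
    IntegrableOn (coverageIntegrand α N lam P τ i) (Set.Ioi 0) := by
  have hℓ : ∀ k, 0 < lam k * (Real.pi * P k ^ (2 / α)) := fun k =>
    mul_pos (hlam k) (mul_pos Real.pi_pos (Real.rpow_pos_of_pos (hP k) _))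
  have hL : 0 < ∑ k, lam k * (Real.pi * P k ^ (2 / α)) :=
    Finset.sum_pos (fun k _ => hℓ k) ⟨i, Finset.mem_univ i⟩
  have hc : 0 < (P i ^ (2 / α))⁻¹ := inv_pos.2 (Real.rpow_pos_of_pos (hP i) _)
  let g := scaledIntegrand α N (τ i) (∑ k, lam k * (Real.pi * P k ^ (2 / α)))
  have h1 : IntegrableOn (fun u => g ((P i ^ (2 / α))⁻¹ * u)) (Set.Ioi 0) := by
    rw [integrableOn_Ioi_comp_mul_left_iff g 0 hc, mul_zero]
    exact integrableOn_scaledIntegrand hN (hτ i) hL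
  exact ((integrableOn_Ioi_comp_rpow_iff' _ two_ne_zero).2 h1).congr_fun
    (fun r hr => (rpow_two_mul_coverageIntegrand hα hP i hr).symm) measurableSet_Ioi

/-- Under `s = r² / P i ^ (2/α)` the Jacobian `2r / P i ^ (2/α)` turns the rate `lam i * π * P i ^
(2/α)` into `2π * lam i * r`. -/
lemma integral_coverageIntegrand (hα : 2 < α) (hP : ∀ k, 0 < P k) (i : κ) :
    2 * Real.pi * lam i * ∫ r in Set.Ioi (0 : ℝ), coverageIntegrand α N lam P τ i r =
      lam i * (Real.pi * P i ^ (2 / α)) * ∫ s in Set.Ioi 0,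
        scaledIntegrand α N (τ i) (∑ k, lam k * (Real.pi * P k ^ (2 / α))) s := by
  have hPi : 0 < P i ^ (2 / α) := Real.rpow_pos_of_pos (hP i) _
  have hc : 0 < (P i ^ (2 / α))⁻¹ := inv_pos.2 hPi
  let g := scaledIntegrand α N (τ i) (∑ k, lam k * (Real.pi * P k ^ (2 / α)))
  have h1 := integral_comp_rpow_Ioi_of_pos (p := 2) two_pos
    (g := fun u => g ((P i ^ (2 / α))⁻¹ * u))
  rw [integral_comp_mul_left_Ioi g 0 hc, mul_zero, inv_inv] at h1
  have h2 : (∫ r in Set.Ioi (0 : ℝ), (2 * r ^ ((2 : ℝ) - 1)) •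
      g ((P i ^ (2 / α))⁻¹ * r ^ (2 : ℝ))) =
      2 * ∫ r in Set.Ioi (0 : ℝ), coverageIntegrand α N lam P τ i r := by
    rw [← integral_const_mul]
    refine setIntegral_congr_fun measurableSet_Ioi fun r hr => ?_
    simp only [rpow_two_mul_coverageIntegrand hα hP i hr, smul_eq_mul]
    ring
  have h3 := h2.symm.trans h1
  rw [smul_eq_mul] at h3
  linear_combination (Real.pi * lam i) * h3

end CoverageIntegrand

lemma integral_scaledIntegrand_zero_noise {τ L : ℝ} (α : ℝ) (hτ : 0 < τ) (hL : 0 < L) :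
    ∫ s in Set.Ioi 0, scaledIntegrand α 0 τ L s = 1 / (L * rho τ α) := by
  have hρ := mul_pos hL (rho_pos hτ α)
  have h := integral_exp_mul_Ioi (a := -(L * rho τ α)) (by linarith) 0
  simp only [scaledIntegrand, mul_zero, zero_mul, neg_zero, Real.exp_zero, one_mul]
  simp only [neg_mul, mul_zero, Real.exp_zero] at h
  rw [h, neg_div_neg_eq]

/-! ### Reduction of the planar network to the half line -/

/-- The squared norm divided by `c`. -/
def scaledSqNorm (c : ℝ) (z : Plane) : ℝ := ‖z‖ ^ 2 / c

@[fun_prop]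
lemma measurable_scaledSqNorm (c : ℝ) : Measurable (scaledSqNorm c) := by
  unfold scaledSqNorm
  fun_prop

lemma halfLineMeasure_Iic (ℓ b : ℝ) :
    halfLineMeasure ℓ (Set.Iic b) = ENNReal.ofReal ℓ * ENNReal.ofReal b := by
  rw [halfLineMeasure, Measure.smul_apply, Measure.restrict_apply measurableSet_Iic, Set.inter_comm,
    Set.Ici_inter_Iic, Real.volume_Icc, smul_eq_mul, sub_zero]

/-- For `b ≥ 0` the preimage of `Iic b` is a disc of area `π * b * c`, linear in `b`. Differences
give agreement on `Ioc` intervals, which determine the measure. -/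
lemma map_scaledSqNorm_volume {lam c : ℝ} (hlam : 0 < lam) (hc : 0 < c) :
    (ENNReal.ofReal lam • (volume : Measure Plane)).map (scaledSqNorm c) =
      halfLineMeasure (lam * (Real.pi * c)) := by
  have hIic : ∀ b, (ENNReal.ofReal lam • (volume : Measure Plane)).map (scaledSqNorm c)
      (Set.Iic b) = halfLineMeasure (lam * (Real.pi * c)) (Set.Iic b) := by
    intro b
    rw [halfLineMeasure_Iic, Measure.map_apply (measurable_scaledSqNorm c) measurableSet_Iic,
      Measure.smul_apply, smul_eq_mul, ENNReal.ofReal_mul hlam.le, mul_assoc]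
    congr 1
    rcases lt_or_ge b 0 with hb | hb
    · have : scaledSqNorm c ⁻¹' Set.Iic b = ∅ := by
        refine Set.eq_empty_of_forall_notMem fun z hz => ?_
        have h1 : 0 ≤ scaledSqNorm c z := by unfold scaledSqNorm; positivity
        exact (h1.trans hz).not_gt hb
      rw [this, measure_empty, ENNReal.ofReal_of_nonpos hb.le, mul_zero]
    · have : scaledSqNorm c ⁻¹' Set.Iic b = Metric.closedBall 0 (Real.sqrt (b * c)) := by
        ext z
        rw [Set.mem_preimage, Set.mem_Iic, scaledSqNorm, div_le_iff₀ hc, mem_closedBall_zero_iff,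
          Real.le_sqrt (norm_nonneg z) (by positivity)]
      rw [this, EuclideanSpace.volume_closedBall_fin_two, ← ENNReal.ofReal_pow (by positivity),
        Real.sq_sqrt (by positivity), ← ENNReal.ofReal_mul (by positivity),
        ← ENNReal.ofReal_mul (by positivity)]
      congr 1
      ring
  have hfin : ∀ b, halfLineMeasure (lam * (Real.pi * c)) (Set.Iic b) ≠ ∞ := fun b => by
    rw [halfLineMeasure_Iic]
    exact ENNReal.mul_ne_top ENNReal.ofReal_ne_top ENNReal.ofReal_ne_top
  refine (Measure.ext_of_Ioc' _ _ (fun a b _ => ?_) fun a b hab => ?_).symm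
  · exact ((measure_mono Set.Ioc_subset_Iic_self).trans_lt (hfin b).lt_top).ne
  · rw [← Set.Iic_sdiff_Iic, measure_sdiff (Set.Iic_subset_Iic.2 hab.le)
      measurableSet_Iic.nullMeasurableSet (hfin a), measure_sdiff (Set.Iic_subset_Iic.2 hab.le)
      measurableSet_Iic.nullMeasurableSet (by rw [hIic]; exact hfin a), hIic, hIic]

lemma map_scaledSqNorm_countingMeasure (c : ℝ) (x : ℕ → Plane) :
    (countingMeasure x).map (scaledSqNorm c) =
      Measure.sum fun n => Measure.dirac (scaledSqNorm c (x n)) := by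
  rw [countingMeasure, Measure.map_sum (measurable_scaledSqNorm c).aemeasurable]
  simp_rw [Measure.map_dirac' (measurable_scaledSqNorm c)]

lemma scaledSqNorm_rpow_neg {α p : ℝ} (hα : 0 < α) (hp : 0 < p) (z : Plane) :
    scaledSqNorm (p ^ (2 / α)) z ^ (-(α / 2)) = p * ‖z‖ ^ (-α) := by
  have hc : 0 < p ^ (2 / α) := Real.rpow_pos_of_pos hp _
  have h1 : (p ^ (2 / α)) ^ (-(α / 2)) = p⁻¹ := by
    rw [← Real.rpow_mul hp.le, ← Real.rpow_neg_one]
    congr 1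
    field_simp
  have h2 : (‖z‖ ^ 2) ^ (-(α / 2)) = ‖z‖ ^ (-α) := by
    rw [← Real.rpow_natCast, ← Real.rpow_mul (norm_nonneg z)]
    congr 1
    push_cast
    ring
  rw [scaledSqNorm, Real.div_rpow (by positivity) hc.le, h1, h2, div_inv_eq_mul, mul_comm]

namespace IsPoissonHetNet

variable {Ω κ : Type*} [MeasurableSpace Ω] {μ : Measure Ω} {lam : κ → ℝ}
  {X : κ → ℕ → Ω → Plane} {h : κ → ℕ → Ω → ℝ}

/-- The squared distances of the base stations of tier `k`, divided by `P k ^ (2 / α)`, form a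
Poisson process on the half line. -/
theorem isPoissonLineNet (hnet : IsPoissonHetNet μ lam X h) (hlam : ∀ k, 0 < lam k) {P : κ → ℝ}
    (hP : ∀ k, 0 < P k) (α : ℝ) :
    IsPoissonLineNet μ (fun k => lam k * (Real.pi * P k ^ (2 / α)))
      (fun p ω => scaledSqNorm (P p.1 ^ (2 / α)) (X p.1 p.2 ω)) (fun p ω => h p.1 p.2 ω) := by
  have hc : ∀ k, 0 < P k ^ (2 / α) := fun k => Real.rpow_pos_of_pos (hP k) _
  have hpts : ∀ k ω, tierPoints
      (fun p : κ × ℕ => scaledSqNorm (P p.1 ^ (2 / α)) (X p.1 p.2 ω)) k =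
      (countingMeasure fun n => X k n ω).map (scaledSqNorm (P k ^ (2 / α))) := fun k ω => by
    rw [map_scaledSqNorm_countingMeasure, tierPoints]
  have hpoisson : ∀ k, IsPoissonPointProcess μ
      (fun ω => (countingMeasure fun n => X k n ω).map (scaledSqNorm (P k ^ (2 / α))))
      (halfLineMeasure (lam k * (Real.pi * P k ^ (2 / α)))) := fun k => by
    rw [← map_scaledSqNorm_volume (hlam k) (hc k)]
    exact (hnet.poisson k).map (measurable_scaledSqNorm _)
  have hindep : iIndepFun (fun k ω =>
      (countingMeasure fun n => X k n ω).map (scaledSqNorm (P k ^ (2 / α)))) μ :=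
    hnet.indep_tiers.comp (fun k m => m.map (scaledSqNorm (P k ^ (2 / α))))
      fun k => Measure.measurable_map _ (measurable_scaledSqNorm _)
  have hscale : Measurable fun (x : κ × ℕ → Plane) p => scaledSqNorm (P p.1 ^ (2 / α)) (x p) :=
    measurable_pi_lambda _ fun p => (measurable_scaledSqNorm _).comp (measurable_pi_apply p)
  have hloc := hnet.indep_location_fading.comp hscale measurable_id
  exact
    { nonneg := fun p ω => div_nonneg (by positivity) (hc p.1).le
      measurable_location := fun p =>
        (measurable_scaledSqNorm _).comp (hnet.measurable_location p.1 p.2)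
      measurable_fading := fun p => hnet.measurable_fading p.1 p.2
      poisson := fun k => by
        simp only [hpts]
        exact hpoisson k
      indep_tiers := by
        simp only [hpts]
        exact hindep
      fading_law := fun p => hnet.fading_law p.1 p.2
      fading_indep := hnet.fading_indep
      indep_location_fading := hloc }

end IsPoissonHetNet

/-- The events agree for every outcome, with no null set removed, because the power identity
`scaledSqNorm_rpow_neg` holds even at the origin. -/
lemma coverageEvent_eq_coverage {Ω κ : Type*} {α : ℝ} (hα : 0 < α) (N₀ : ℝ) {P : κ → ℝ}
    (hP : ∀ k, 0 < P k) (τ : κ → ℝ) (X : κ → ℕ → Ω → Plane) (h : κ → ℕ → Ω → ℝ) :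
    coverageEvent α N₀ P τ X h = IsPoissonLineNet.coverage (α / 2) N₀ τ
      (fun p ω => scaledSqNorm (P p.1 ^ (2 / α)) (X p.1 p.2 ω)) (fun p ω => h p.1 p.2 ω) := by
  ext ω
  have hrec : ∀ k n, receivedPower α P X h k n ω = P k * ‖X k n ω‖ ^ (-α) * h k n ω :=
    fun k n => by rw [receivedPower]; ring
  simp only [coverageEvent, tierCoverage, IsPoissonLineNet.coverage, Set.mem_iUnion,
    Set.mem_ofPred_eq, Prod.exists, Prod.forall, ExceedsSinr, IsServing, sinr, interference,
    averagePower, hrec, scaledSqNorm_rpow_neg hα (hP _)]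

lemma IsPoissonLineNet.measurableSet_coverage {Ω κ : Type*} [MeasurableSpace Ω] [Fintype κ]
    {μ : Measure Ω} {ℓ : κ → ℝ} {T H : κ × ℕ → Ω → ℝ} (hnet : IsPoissonLineNet μ ℓ T H)
    (β N : ℝ) (τ : κ → ℝ) : MeasurableSet (coverage β N τ T H) := by
  have h : coverage β N τ T H = ⋃ p : κ × ℕ, event β N (τ p.1) T H p
      (⋂ q, {t : κ × ℕ → ℝ | t q ^ (-β) ≤ t p ^ (-β)}) := by
    ext ω
    simp [coverage, event]
  rw [h]
  exact MeasurableSet.iUnion fun p => hnet.measurableSet_event p (MeasurableSet.iInter fun q =>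
    measurableSet_le ((measurable_pi_apply q).pow_const _) ((measurable_pi_apply p).pow_const _))

end

theorem mainTheorem8 {Ω κ : Type*} [MeasurableSpace Ω] [Fintype κ]
    (μ : Measure Ω) [IsProbabilityMeasure μ]
    (α N₀ : ℝ) (lam P τ : κ → ℝ)
    (hα : 2 < α) (hN₀ : 0 ≤ N₀)
    (hlam : ∀ k, 0 < lam k) (hP : ∀ k, 0 < P k) (hτ : ∀ k, 0 < τ k)
    (X : κ → ℕ → Ω → Plane) (h : κ → ℕ → Ω → ℝ)
    (hnet : IsPoissonHetNet μ lam X h) :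
    MeasurableSet (coverageEvent α N₀ P τ X h) ∧
    (∀ i, IntegrableOn (fun t : ℝ => 1 / (1 + t ^ (α / 2))) (Set.Ioi (τ i ^ (-(2 / α))))) ∧
    (∀ i, IntegrableOn (coverageIntegrand α N₀ lam P τ i) (Set.Ioi 0)) ∧
    μ.real (coverageEvent α N₀ P τ X h) =
      ∑ i, 2 * Real.pi * lam i * ∫ r in Set.Ioi (0 : ℝ), coverageIntegrand α N₀ lam P τ i r ∧
    (N₀ = 0 →
      μ.real (coverageEvent α N₀ P τ X h) =
        ∑ i, lam i * P i ^ (2 / α) / ∑ j, lam j * P j ^ (2 / α) * rho (τ i) α) := by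
  have hline := hnet.isPoissonLineNet hlam hP α
  have hℓ : ∀ k, 0 < lam k * (Real.pi * P k ^ (2 / α)) := fun k =>
    mul_pos (hlam k) (mul_pos Real.pi_pos (Real.rpow_pos_of_pos (hP k) _))
  have hprob := hline.measureReal_coverage hα hN₀ hτ hℓ
  rw [coverageEvent_eq_coverage (by linarith) N₀ hP τ X h]
  refine ⟨hline.measurableSet_coverage _ _ _, fun i => ?_, fun i => ?_, ?_, fun hN => ?_⟩
  · exact integrableOn_one_div_one_add_rpow (by linarith) (Real.rpow_pos_of_pos (hτ i) _)
  · exact integrableOn_coverageIntegrand hα hN₀ hlam hP hτ i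
  · rw [hprob]
    exact Finset.sum_congr rfl fun i _ => (integral_coverageIntegrand hα hP i).symm
  · rw [hprob, hN]
    refine Finset.sum_congr rfl fun i _ => ?_
    have hL : 0 < ∑ k, lam k * (Real.pi * P k ^ (2 / α)) :=
      Finset.sum_pos (fun k _ => hℓ k) ⟨i, Finset.mem_univ i⟩
    have hsum : ∑ k, lam k * (Real.pi * P k ^ (2 / α)) =
        Real.pi * ∑ k, lam k * P k ^ (2 / α) := by
      rw [Finset.mul_sum]
      exact Finset.sum_congr rfl fun k _ => by ring
    rw [integral_scaledIntegrand_zero_noise α (hτ i) hL, hsum, ← Finset.sum_mul]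
    rw [hsum] at hL
    have hL' : 0 < ∑ k, lam k * P k ^ (2 / α) := pos_of_mul_pos_right hL Real.pi_pos.le
    have hρ := rho_pos (hτ i) α
    field_simp
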